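/- Let $\alpha\in(0,2)$, $T>0$, $M_1,M_2>0$. Let $H^1_\alpha(0,1)$ be the space of all $v\in L^2(0,1)$ that are locally absolutely continuous on $(0,1]$ with $x^{\alpha/2}v_x\in L^2(0,1)$ and $v(1)=0$. Let $BC_\alpha(v)=v|_{x=0}$ if $\alpha\in(0,1)$ and $BC_\alpha(v)=(x^\alpha v_x)|_{x=0}$ if $\alpha\in[1,2)$, and let $Av=(x^\alpha v_x)_x$ with domain $D(A)=\{v\in H^1_\alpha(0,1):(x^\alpha v_x)_x\in L^2(0,1),\ BC_\alpha(v)=0\}$. Let $\omega,\omega_1,\omega_2\subset(0,1)$ be measurable sets of positive measure, let $G_1,G_2\subset(0,1)$ be measurable with $\omega_i\subset G_i$ $(i=1,2)$, and let $y_0,y_T^1,y_T^2\in L^2(0,1)$ with $y_T^1\neq y_T^2$. Let $g\in L^\infty(0,T;L^2(0,1))$ be given. For $u_1,u_2\in L^\infty(0,T;L^2(0,1))$ consider the system $$y_t=Ay+\chi_\omega g+\chi_{\omega_1}u_1+\chi_{\omega_2}u_2\ \text{ in }(0,1)\times(0,T),\qquad y(1,t)=BC_\alpha(y(\cdot,t))=0\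 \text{ for } t\in(0,T),\qquad y(\cdot,0)=y_0 .$$ A (weak) solution is a function $y\in C([0,T];L^2(0,1))\cap L^2(0,T;H^1_\alpha(0,1))$ with $y(0)=y_0$, with $y(t)|_{x=0}=0$ for a.e. $t\in(0,T)$ if $\alpha<1$, and with $$\langle y(t),v\rangle=\langle y_0,v\rangle+\int_0^t\big(\langle y(s),Av\rangle+\langle \chi_\omega g(s)+\chi_{\omega_1}u_1(s)+\chi_{\omega_2}u_2(s),v\rangle\big)\,ds\qquad\text{for all } v\in D(A),\ t\in[0,T],$$ where $\langle\cdot,\cdot\rangle$ is the scalar product of $L^2(0,1)$. Then for all $u_1,u_2\in L^\infty(0,T;L^2(0,1))$ this system has exactly one solution $y(\cdot;y_0,g,u_1,u_2)$ on $[0,T]$. Moreover, with $$\mathcal U_i=\{u\in L^\infty(0,T;L^2(0,1)):\|u\|_{L^\infty(0,T;L^2(0,1))}\le M_i\},\qquad J_i(u_1,u_2)=\|y(T;y_0,g,u_1,u_2)-y_T^i\|_{L^2(G_i)}\qquad(i=1,2),$$ there exists at least one Stackelberg–Nash equilibrium with respect to $g$, i.e. a pair $(u_1^*,u_2^*)\in\mathcal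 U_1\times\mathcal U_2$ such that $$J_1(u_1^*,u_2^*)\le J_1(u_1,u_2^*)\ \text{ for all }u_1\in\mathcal U_1\qquad\text{and}\qquad J_2(u_1^*,u_2^*)\le J_2(u_1^*,u_2)\ \text{ for all }u_2\in\mathcal U_2 .$$ -/

import Mathlib

open MeasureTheory Set Filter Topology

namespace DegenerateGame

/-- Lebesgue measure on the space interval `I = (0,1)`. -/
noncomputable abbrev muI : Measure ℝ := volume.restrict (Ioo (0 : ℝ) 1)

/-- The real Hilbert space `L²(0,1)`. -/
abbrev L2I : Type := Lp ℝ 2 muI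

/-- The space `L^∞(0,T; L²(0,1))` of (classes of) strongly measurable, essentially bounded
functions of time with values in `L²(0,1)`; its norm is the essential supremum of `t ↦ ‖u(t)‖`. -/
abbrev Control (T : ℝ) : Type := Lp L2I ⊤ (volume.restrict (Ioo (0 : ℝ) T))

/-- The weighted space `H¹_α(0,1)`: functions `v ∈ L²(0,1)`, locally absolutely continuous
on `(0,1]`, with `x^{α/2} v_x ∈ L²(0,1)` and `v(1) = 0`. -/
structure MemH1 (α : ℝ) (v : ℝ → ℝ) : Prop where
  memL2 : MemLp v 2 muI
  absCont : ∀ a ∈ Ioo (0 : ℝ) 1, AbsolutelyContinuousOnInterval v a 1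
  weightedDeriv : MemLp (fun x => x ^ (α / 2) * deriv v x) 2 muI
  right_zero : v 1 = 0

/-- The flux `x^α v_x`. -/
noncomputable def flux (α : ℝ) (v : ℝ → ℝ) : ℝ → ℝ := fun x => x ^ α * deriv v x

/-- The differential expression `A v = (x^α v_x)_x`. -/
noncomputable def opA (α : ℝ) (v : ℝ → ℝ) : ℝ → ℝ := deriv (flux α v)

/-- The boundary condition `BC_α(v) = 0` at the degenerate end `x = 0`: the Dirichlet condition
`v(0) = 0` if `α < 1`, the zero flux condition `(x^α v_x)(0) = 0` if `1 ≤ α`. -/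
def BCZero (α : ℝ) (v : ℝ → ℝ) : Prop :=
  (α < 1 → Tendsto v (𝓝[>] 0) (𝓝 0)) ∧ (1 ≤ α → Tendsto (flux α v) (𝓝[>] 0) (𝓝 0))

/-- The domain `D(A)`: functions `v ∈ H¹_α(0,1)` whose flux is locally absolutely continuous in
`(0,1)` with `(x^α v_x)_x ∈ L²(0,1)`, and with `BC_α(v) = 0`. -/
structure MemDomA (α : ℝ) (v : ℝ → ℝ) : Prop where
  memH1 : MemH1 α v
  fluxAbsCont : ∀ a b : ℝ, 0 < a → a ≤ b → b < 1 → AbsolutelyContinuousOnInterval (flux α v) a b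
  memL2 : MemLp (opA α v) 2 muI
  bc : BCZero α v

/-- The right-hand side `χ_ω g + χ_{ω₁} u₁ + χ_{ω₂} u₂` at time `t` and point `x`. -/
noncomputable def source {T : ℝ} (ω ω₁ ω₂ : Set ℝ) (g u₁ u₂ : Control T) (t x : ℝ) : ℝ :=
  ω.indicator (g t) x + ω₁.indicator (u₁ t) x + ω₂.indicator (u₂ t) x

/-- `y` is a weak solution, in `C([0,T]; L²(0,1)) ∩ L²(0,T; H¹_α(0,1))`, of
`y_t = A y + χ_ω g + χ_{ω₁} u₁ + χ_{ω₂} u₂`, `y(1,t) = BC_α(y(·,t)) = 0`, `y(0) = y₀`.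

The equation is tested against all `v ∈ D(A)` (`A` is self-adjoint), in the form integrated in
time: `t ↦ ⟨y(t), v⟩` is absolutely continuous with derivative
`⟨y(t), A v⟩ + ⟨χ_ω g(t) + χ_{ω₁} u₁(t) + χ_{ω₂} u₂(t), v⟩`. For `v ∈ D(A)` and smooth `y`, no
boundary term is left on integrating by parts exactly when `y` satisfies the boundary conditions.
The conditions that have a meaning as traces in `H¹_α(0,1)`, namely `y(1,t) = 0` and, for `α < 1`,
`y(0,t) = 0`, are moreover imposed explicitly; only the values of `y` on `[0,T]` matter. -/
structure IsSolution (α T : ℝ) (ω ω₁ ω₂ : Set ℝ) (y₀ : L2I) (g u₁ u₂ : Control T)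
    (y : ℝ → L2I) : Prop where
  continuousOn : ContinuousOn y (Icc 0 T)
  initial : y 0 = y₀
  energy : ∃ Y : ℝ → ℝ → ℝ,
    (∀ᵐ t ∂(volume.restrict (Ioo (0 : ℝ) T)),
      (y t : ℝ → ℝ) =ᵐ[muI] Y t ∧ MemH1 α (Y t) ∧ (α < 1 → Tendsto (Y t) (𝓝[>] 0) (𝓝 0))) ∧
    ∫⁻ t in Ioo (0 : ℝ) T, ∫⁻ x in Ioo (0 : ℝ) 1,
      ENNReal.ofReal ((x ^ (α / 2) * deriv (Y t) x) ^ 2) < ⊤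
  equation : ∀ v : ℝ → ℝ, MemDomA α v → ∀ t ∈ Icc (0 : ℝ) T,
    ∫ x in Ioo (0 : ℝ) 1, y t x * v x =
      (∫ x in Ioo (0 : ℝ) 1, y₀ x * v x) +
      ∫ s in Ioo (0 : ℝ) t,
        ((∫ x in Ioo (0 : ℝ) 1, y s x * opA α v x) +
          ∫ x in Ioo (0 : ℝ) 1, source ω ω₁ ω₂ g u₁ u₂ s x * v x)

/-- The admissible set `{u ∈ L^∞(0,T; L²(0,1)) : ‖u‖ ≤ M}`. -/
def admissible (T M : ℝ) : Set (Control T) := {u | ‖u‖ ≤ M}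

/-- The distance `‖z - yT‖_{L²(G)}` of a final state `z` to a target `yT`. -/
noncomputable def cost (G : Set ℝ) (yT z : L2I) : ℝ :=
  (eLpNorm (fun x => z x - yT x) 2 (volume.restrict G)).toReal

/-- `(u₁, u₂)` is a Nash equilibrium of the cost functionals `J₁, J₂` over `U₁ × U₂`. -/
def IsNashEquilibrium {X₁ X₂ : Type*} (J₁ J₂ : X₁ → X₂ → ℝ) (U₁ : Set X₁) (U₂ : Set X₂)
    (u₁ : X₁) (u₂ : X₂) : Prop :=
  u₁ ∈ U₁ ∧ u₂ ∈ U₂ ∧ (∀ v₁ ∈ U₁, J₁ u₁ u₂ ≤ J₁ v₁ u₂) ∧ ∀ v₂ ∈ U₂, J₂ u₁ u₂ ≤ J₂ u₁ v₂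

end DegenerateGame

-- The operator `-A` is the inverse of `C C†`, where `C` (`factorOp`) inverts the first-order
-- operator `v ↦ -x^{α/2} v_x` on the functions of `H¹_α` that vanish at `1` and, for `α < 1`, at
-- `0`. Explicitly, `C` is `q ↦ ∫ₓ¹ s^{-α/2} q(s) ds` after a projection that encodes the condition
-- at `0`. The squared norm of its kernel is at most a multiple of `x^{-α/2}`, integrable because `α
-- < 2`, so `C` is Hilbert–Schmidt. Hence `C C†` is compact, symmetric and injective, and has a
-- Hilbert basis of eigenvectors with eigenvalues `0 < κᵢ ≤ κm`.
--
-- In this basis the weak formulation is equivalent to the scalar equations `yᵢ' = -κᵢ⁻¹ yᵢ + fᵢ`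
-- (`IsSolution.isCoordSolution`, `IsCoordSolution.isSolution`), which Duhamel's formula solves
-- uniquely. The scalar energy inequality `energy_le`, summed over `i`, gives the `L²(0,T;H¹_α)`
-- regularity. For zero initial data it also bounds `∑ κᵢ⁻¹ yᵢ(T)²` by `∫ ‖f‖²`, and this sum is
-- `‖q‖²` for some `q` with `C q = y(T)`.
--
-- So the states reached at time `T` with controls from a ball of `L^∞(0,T;L²)` lie in the image
-- under `C` of a ball. They form a closed set by weak compactness, hence a compact convex one
-- (`isCompact_reachSet`). The final state is a fixed vector plus one reached state per player, and
-- each cost is a convex continuous function of it. An equilibrium is then a point given by Ky Fan's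
-- inequality, applied to the sum of both players' changes of cost; Ky Fan's inequality follows from
-- Brouwer's theorem, which is proved by the Milnor–Rogers volume argument.

universe u

namespace DegenerateGame

/-! ### No `C¹` retraction onto a sphere. -/

section Brouwer

theorem image_eq_self_of_eqOn_compl {X : Type*} {F : X → X} (hF : Function.Bijective F) {B : Set X}
    (h : ∀ x, x ∉ B → F x = x) : F '' B = B := by
  ext y
  constructor
  · rintro ⟨x, hx, rfl⟩
    by_contra hn
    have := hF.1 (h _ hn)
    exact hn (this.symm ▸ hx)
  · intro hy
    obtain ⟨x, rfl⟩ := hF.2 y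
    by_contra hn
    have hx : x ∉ B := fun hx => hn ⟨x, hx, rfl⟩
    rw [h x hx] at hy
    exact hx hy

variable {E : Type*} [NormedAddCommGroup E] [InnerProductSpace ℝ E] [FiniteDimensional ℝ E]

/-- The degree bound allows the value at `t = 1` to be recovered from the values at `finrank + 1`
small parameters. -/
theorem exists_polynomial_det_one_add_smul (A : E →L[ℝ] E) :
    ∃ p : Polynomial ℝ, p.natDegree ≤ Module.finrank ℝ E ∧
      ∀ t : ℝ, p.eval t = (1 + t • A : E →L[ℝ] E).det := by
  let b := Module.finBasis ℝ E
  let M := LinearMap.toMatrix b b A.toLinearMap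
  refine ⟨Matrix.det ((Polynomial.X : Polynomial ℝ) • M.map Polynomial.C +
    (1 : Matrix _ _ ℝ).map Polynomial.C), ?_, fun t => ?_⟩
  · simpa using Polynomial.natDegree_det_X_add_C_le M 1
  · have h1 : (1 + t • A : E →L[ℝ] E).det = LinearMap.det (1 + t • A.toLinearMap) := rfl
    rw [h1, ← LinearMap.det_toMatrix b, ← Polynomial.coe_evalRingHom, RingHom.map_det]
    congr 1
    ext i j
    by_cases hij : i = j <;> simp [M, hij, LinearMap.toMatrix_one] <;> ring

omit [FiniteDimensional ℝ E] in
/-- The extension by zero of a map vanishing on a sphere is Lipschitz. -/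
theorem lipschitzWith_indicator_ball {φ : E → E} {K : NNReal} {R : ℝ} (hR : 0 < R)
    (hφ : LipschitzOnWith K φ (Metric.closedBall 0 R)) (h0 : ∀ x, ‖x‖ = R → φ x = 0) :
    LipschitzWith K ((Metric.ball 0 R).indicator φ) := by
  have key : ∀ x y : E, ‖x‖ < R → R ≤ ‖y‖ → ‖φ x‖ ≤ K * ‖x - y‖ := by
    intro x y hx hy
    -- The radial projection of `x` to the sphere works, since its distance to `x` is `R - ‖x‖ ≤ ‖y‖
    -- - ‖x‖`. At `x = 0` there is no radial direction and that of `y` is used.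
    obtain ⟨z, hz, hzx⟩ : ∃ z : E, ‖z‖ = R ∧ ‖x - z‖ ≤ ‖x - y‖ := by
      by_cases hx0 : x = 0
      · have hy0 : 0 < ‖y‖ := hR.trans_le hy
        refine ⟨(R / ‖y‖) • y, ?_, ?_⟩
        · rw [norm_smul, Real.norm_of_nonneg (by positivity)]; field_simp
        · rw [hx0, zero_sub, zero_sub, norm_neg, norm_neg, norm_smul,
            Real.norm_of_nonneg (by positivity)]
          field_simp; exact hy
      · have hx0 : 0 < ‖x‖ := norm_pos_iff.2 hx0
        refine ⟨(R / ‖x‖) • x, ?_, ?_⟩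
        · rw [norm_smul, Real.norm_of_nonneg (by positivity)]; field_simp
        · have : x - (R / ‖x‖) • x = -((R / ‖x‖ - 1) • x) := by rw [sub_smul, one_smul]; abel
          rw [this, norm_neg, norm_smul, Real.norm_of_nonneg]
          · have h1 : (R / ‖x‖ - 1) * ‖x‖ = R - ‖x‖ := by field_simp
            rw [h1]
            have := norm_sub_norm_le y x
            rw [norm_sub_rev] at this
            linarith
          · rw [sub_nonneg, le_div_iff₀ hx0]; linarith
    have := hφ.dist_le_mul x (by simpa using hx.le) z (by simp [hz])
    rw [h0 z hz, dist_zero_right, dist_eq_norm] at this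
    exact this.trans (by gcongr)
  refine LipschitzWith.of_dist_le_mul fun x y => ?_
  by_cases hx : ‖x‖ < R <;> by_cases hy : ‖y‖ < R
  · simpa [hx, hy] using hφ.dist_le_mul x (by simpa using hx.le) y (by simpa using hy.le)
  · simpa [hx, hy, dist_eq_norm] using key x y hx (not_lt.1 hy)
  · have := key y x hy (not_lt.1 hx)
    rw [norm_sub_rev] at this
    simpa [hx, hy, dist_eq_norm] using this
  · simp only [indicator, Metric.mem_ball, dist_zero_right, hx, hy, if_false, dist_self]
    positivity

/-- Milnor–Rogers argument: the volume of the image of the ball under `x + t (r x - x)` is a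
polynomial in `t`. It is constant for small `t > 0`, where the map permutes the ball, so the
integral of the determinant is still the volume of the ball at `t = 1`. There the determinant is
that of `r'`, which vanishes since `r` takes values in a sphere. -/
theorem not_exists_contDiff_retraction {r : E → E} (hr : ContDiff ℝ 1 r) {R : ℝ} (hR : 0 < R)
    (hnorm : ∀ x, ‖r x‖ = R) (hid : ∀ x, ‖x‖ = R → r x = x) : False := by
  borelize E
  set μ : Measure E := MeasureTheory.Measure.addHaar
  set B : Set E := Metric.ball 0 R
  set A : E → E →L[ℝ] E := fun x => fderiv ℝ r x - 1
  have hAc : Continuous A := (hr.continuous_fderiv one_ne_zero).sub continuous_const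
  have hφ : ContDiff ℝ 1 (fun x => r x - x) := hr.sub contDiff_id
  have hφd : ∀ x, HasFDerivAt (fun x => r x - x) (A x) x := fun x =>
    ((hr.differentiable one_ne_zero x).hasFDerivAt).sub (hasFDerivAt_id x)
  obtain ⟨K, hK⟩ := (hφ.contDiffOn (s := Metric.closedBall 0 R)).exists_lipschitzOnWith
    one_ne_zero (convex_closedBall _ _) (isCompact_closedBall _ _)
  have hlip := lipschitzWith_indicator_ball hR hK (fun x hx => by simp [hid x hx])
  obtain ⟨c, hc⟩ : ∃ c, ∀ x ∈ Metric.closedBall (0 : E) R, ‖A x‖ ≤ c :=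
    (isCompact_closedBall _ _).exists_bound_of_continuousOn hAc.continuousOn
  -- Positivity removes the absolute value from the change of variables formula, which would spoil
  -- the polynomial dependence on `t`.
  have hdet : ∀ᶠ N : E →L[ℝ] E in 𝓝 0, 0 < (1 + N).det := by
    have : ContinuousAt (fun N : E →L[ℝ] E => (1 + N).det) 0 :=
      (ContinuousLinearMap.continuous_det.comp (continuous_const.add continuous_id)).continuousAt
    refine this.eventually (lt_mem_nhds ?_)
    have : (1 + 0 : E →L[ℝ] E).det = LinearMap.det (1 : E →ₗ[ℝ] E) := by rw [add_zero]; rfl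
    simp only [this, map_one, one_pos]
  obtain ⟨ε, hε, hεdet⟩ := Metric.eventually_nhds_iff.1 hdet
  have hBfin : μ B ≠ ⊤ := measure_ball_lt_top.ne
  -- For small `t` the map `F` is a Lipschitz perturbation of the identity, hence bijective. It
  -- fixes the complement of `B`, so `F '' B = B`.
  have hvol : ∀ t : ℝ, 0 < t → t * (K + 1) < 1 → t * (|c| + 1) < ε →
      ∫ x in B, (1 + t • A x).det ∂μ = μ.real B := by
    intro t ht htK htc
    lift t to NNReal using ht.le
    set F : E → E := fun x => x + (t : ℝ) • B.indicator (fun x => r x - x) x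
    have hF : ApproximatesLinearOn F ((ContinuousLinearEquiv.refl ℝ E : E ≃L[ℝ] E) : E →L[ℝ] E)
        univ (t * K) := by
      intro x _ y _
      have h1 := hlip.dist_le_mul x y
      rw [dist_eq_norm] at h1
      have h2 : F x - F y - ((ContinuousLinearEquiv.refl ℝ E : E ≃L[ℝ] E) : E →L[ℝ] E) (x - y) =
          (t : ℝ) • (B.indicator (fun x => r x - x) x - B.indicator (fun x => r x - x) y) := by
        simp only [F, ContinuousLinearEquiv.coe_refl, ContinuousLinearMap.coe_id', id, smul_sub]
        abel
      rw [h2, norm_smul, Real.norm_of_nonneg ht.le]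
      push_cast
      rw [mul_assoc, ← dist_eq_norm x y]
      exact mul_le_mul_of_nonneg_left h1 ht.le
    have hsmall : Subsingleton E ∨ t * K <
        ‖((ContinuousLinearEquiv.refl ℝ E : E ≃L[ℝ] E).symm : E →L[ℝ] E)‖₊⁻¹ := by
      rcases subsingleton_or_nontrivial E with h | h
      · exact Or.inl h
      · right
        have : ‖((ContinuousLinearEquiv.refl ℝ E : E ≃L[ℝ] E).symm : E →L[ℝ] E)‖₊ = 1 := by
          ext; simp
        rw [this, inv_one, ← NNReal.coe_lt_coe]
        push_cast
        nlinarith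
    have hbij : Function.Bijective F := ⟨injOn_univ.1 (hF.injOn hsmall), hF.surjective hsmall⟩
    have hout : ∀ x, x ∉ B → F x = x := fun x hx => by simp [F, hx]
    have himg := image_eq_self_of_eqOn_compl hbij hout
    have hder : ∀ x ∈ B, HasFDerivWithinAt F (1 + (t : ℝ) • A x) B x := by
      intro x hx
      have h1 : HasFDerivAt (fun x => x + (t : ℝ) • (r x - x)) (1 + (t : ℝ) • A x) x :=
        (hasFDerivAt_id x).add ((hφd x).const_smul (t : ℝ))
      refine h1.hasFDerivWithinAt.congr (fun y hy => ?_) ?_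
      · simp [F, hy]
      · simp [F, hx]
    have h := integral_image_eq_integral_abs_det_fderiv_smul μ measurableSet_ball hder
      hbij.1.injOn (fun _ => (1 : ℝ))
    rw [himg] at h
    simp only [integral_const, smul_eq_mul, mul_one, measureReal_restrict_apply_univ] at h
    rw [h]
    refine setIntegral_congr_fun measurableSet_ball fun x hx => ?_
    refine (abs_of_pos (hεdet ?_)).symm
    have hcx := hc x (Metric.ball_subset_closedBall hx)
    rw [dist_zero_right, norm_smul, Real.norm_of_nonneg ht.le]
    refine lt_of_le_of_lt ?_ htc
    have := le_abs_self c
    gcongr; linarith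
  set n := Module.finrank ℝ E
  obtain ⟨δ, hδ, hδK, hδc⟩ : ∃ δ : ℝ, 0 < δ ∧ δ * (K + 1) ≤ 1 ∧ δ * (|c| + 1) ≤ ε := by
    refine ⟨min (1 / (K + 1)) (ε / (|c| + 1)), by positivity, ?_, ?_⟩
    · rw [← le_div_iff₀ (by positivity)]; exact min_le_left _ _
    · rw [← le_div_iff₀ (by positivity)]; exact min_le_right _ _
  -- Interpolation nodes: `n + 1` distinct points of `(0, δ)`; the shift by `2` keeps the first one
  -- strictly below `δ`.
  set v : ℕ → ℝ := fun j => δ / (j + 2)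
  have hvpos : ∀ j, 0 < v j := fun j => by positivity
  have hvlt : ∀ j, v j < δ := fun j => by
    rw [div_lt_iff₀ (by positivity)]
    nlinarith [Nat.cast_nonneg (α := ℝ) j]
  have hvinj : Set.InjOn v (Finset.range (n + 1)) := by
    intro i _ j _ hij
    simp only [v] at hij
    rw [div_eq_div_iff (by positivity) (by positivity)] at hij
    have := mul_left_cancel₀ hδ.ne' hij
    exact_mod_cast (by linarith : (i : ℝ) = j)
  have hinterp : ∀ x, (1 + (1 : ℝ) • A x).det = ∑ j ∈ Finset.range (n + 1),
      (1 + v j • A x).det * (Lagrange.basis (Finset.range (n + 1)) v j).eval 1 := by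
    intro x
    obtain ⟨p, hp, hpe⟩ := exists_polynomial_det_one_add_smul (A x)
    have h := Lagrange.eq_interpolate (f := p) hvinj (by
      refine (Polynomial.degree_le_natDegree).trans_lt ?_
      rw [Finset.card_range]
      exact_mod_cast Nat.lt_succ_of_le hp)
    rw [← hpe]
    conv_lhs => rw [h]
    simp [Lagrange.interpolate_apply, Polynomial.eval_finsetSum, hpe]
  have hzero : ∀ x, (1 + (1 : ℝ) • A x).det = 0 := by
    intro x
    have h1 : (1 + (1 : ℝ) • A x) = fderiv ℝ r x := by simp [A]
    rw [h1]
    -- If `r'(x)` were onto, some `w` would have `r'(x) w = r x`, and the constant function `‖r‖²`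
    -- would have derivative `2 R² ≠ 0` along `w`.
    by_contra hne
    have hsurj : Function.Surjective (fderiv ℝ r x) := by
      have := LinearMap.equivOfDetNeZero (fderiv ℝ r x).toLinearMap hne
      exact (LinearMap.equivOfDetNeZero (fderiv ℝ r x).toLinearMap hne).surjective
    obtain ⟨w, hw⟩ := hsurj (r x)
    have h2 := ((hr.differentiable one_ne_zero x).hasFDerivAt).norm_sq
    have h3 : (fun y => ‖r y‖ ^ 2) = fun _ => R ^ 2 := by ext y; rw [hnorm]
    rw [h3] at h2
    have h4 := h2.unique (hasFDerivAt_const (R ^ 2) x)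
    have h5 := congrArg (fun l => l w) h4
    simp [hw, hnorm] at h5
    exact hR.ne' h5
  have hint : ∀ j, Integrable (fun x => (1 + v j • A x).det) (μ.restrict B) := by
    intro j
    have hcont : Continuous fun x => (1 + v j • A x).det :=
      ContinuousLinearMap.continuous_det.comp (by fun_prop)
    exact (hcont.continuousOn.integrableOn_compact (isCompact_closedBall 0 R)).mono_set Metric.ball_subset_closedBall
  have hsum : ∑ j ∈ Finset.range (n + 1), (Lagrange.basis (Finset.range (n + 1)) v j).eval 1 = 1 := by
    rw [← Polynomial.eval_finsetSum, Lagrange.sum_basis hvinj ⟨0, by simp⟩, Polynomial.eval_one]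
  have hfinal : (0 : ℝ) = μ.real B := by
    have h1 : ∫ x in B, (1 + (1 : ℝ) • A x).det ∂μ = 0 := by
      simp_rw [hzero]; simp
    rw [← h1]
    simp_rw [hinterp]
    rw [integral_finsetSum _ fun j _ => (hint j).mul_const _]
    simp_rw [integral_mul_const]
    rw [Finset.sum_congr rfl fun j _ => by
      rw [hvol (v j) (hvpos j) (lt_of_lt_of_le (by have := hvlt j; gcongr) hδK)
        (lt_of_lt_of_le (by have := hvlt j; gcongr) hδc)]]
    rw [← Finset.mul_sum, hsum, mul_one]
  have hpos : 0 < μ.real B := by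
    rw [measureReal_def]
    exact ENNReal.toReal_pos (Metric.measure_ball_pos μ 0 hR).ne' hBfin
  exact hpos.ne hfinal

end Brouwer
-- Brouwer's theorem on the ball and on the simplex.
section Brouwer

/-- Brouwer's fixed point theorem, for continuous maps with values in the unit ball. -/
theorem exists_fixedPoint_of_norm_le_one {E : Type*} [NormedAddCommGroup E]
    [InnerProductSpace ℝ E] [FiniteDimensional ℝ E] {f : E → E} (hf : Continuous f)
    (hb : ∀ x, ‖f x‖ ≤ 1) : ∃ x, f x = x := by
  by_contra! hne
  obtain ⟨x₀, -, hx₀⟩ := (isCompact_closedBall (0 : E) 2).exists_isMinOn ⟨0, by simp⟩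
    (f := fun x => ‖f x - x‖) (by fun_prop)
  set δ := ‖f x₀ - x₀‖
  have hδ : 0 < δ := norm_pos_iff.2 (sub_ne_zero.2 (hne x₀))
  obtain ⟨p, hp, hpf⟩ : ∃ p : E → E, ContDiff ℝ 1 p ∧
      ∀ x ∈ Metric.closedBall (0 : E) 3, dist (p x) (f x) < min δ 1 := by
    have h := (ContinuousMap.dense_setOfPred_contDiff (E := E) (F := E)) ⟨f, hf⟩
    rw [mem_closure_iff_nhds_basis (nhds_basis_uniformity
      Metric.uniformity_basis_dist.compactConvergenceUniformity)] at h
    obtain ⟨g, hg, hgf⟩ := h (Metric.closedBall 0 3, min δ 1)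
      ⟨isCompact_closedBall _ _, lt_min hδ one_pos⟩
    have hg' : ContDiff ℝ ((⊤ : ℕ∞) : WithTop ℕ∞) g := hg
    exact ⟨g, hg'.of_le (by exact_mod_cast le_top), fun x hx => hgf x hx⟩
  -- The map `h` has no zero. For `‖x‖ ≤ 2` it is `x - p x`, and `p` is closer to `f` than the
  -- minimal displacement `δ`; for `2 < ‖x‖ < 3`, `‖χ x • p x‖ ≤ 2 < ‖x‖`; further out `h x = x`. So
  -- `3 h / ‖h‖` is a retraction to the sphere of radius `3`.
  let χ : ContDiffBump (0 : E) := ⟨2, 3, by norm_num, by norm_num⟩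
  set h : E → E := fun x => x - χ x • p x
  have hne0 : ∀ x, h x ≠ 0 := by
    intro x hx
    have hx : x = χ x • p x := sub_eq_zero.1 hx
    rcases le_or_gt ‖x‖ 2 with h2 | h2
    · have h1 : χ x = 1 := χ.one_of_mem_closedBall (by simpa using h2)
      rw [h1, one_smul] at hx
      have h3 := hpf x (by simp; linarith)
      rw [← hx, dist_comm, dist_eq_norm] at h3
      have h4 := hx₀ (by simpa using h2 : x ∈ Metric.closedBall (0 : E) 2)
      exact absurd (h3.trans_le (min_le_left _ _)) (not_lt.2 h4)
    · rcases lt_or_ge ‖x‖ 3 with h3 | h3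
      · have h4 := hpf x (by simpa using h3.le)
        have h5 : ‖p x‖ ≤ 2 := by
          have := norm_sub_norm_le (p x) (f x)
          rw [dist_eq_norm] at h4
          have := hb x
          have := min_le_right δ 1
          linarith
        have h6 : ‖x‖ ≤ 1 * 2 := by
          conv_lhs => rw [hx]
          rw [norm_smul, Real.norm_of_nonneg χ.nonneg]
          exact mul_le_mul χ.le_one h5 (norm_nonneg _) zero_le_one
        linarith
      · have h1 : χ x = 0 := χ.zero_of_le_dist (by simpa using h3)
        rw [h1, zero_smul] at hx
        rw [hx, norm_zero] at h2
        linarith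
  have hh : ContDiff ℝ 1 h := contDiff_id.sub (χ.contDiff.smul hp)
  refine not_exists_contDiff_retraction (r := fun x => (3 * ‖h x‖⁻¹) • h x) (R := 3) ?_
    (by norm_num) ?_ ?_
  · exact (contDiff_const.mul ((hh.norm ℝ hne0).inv fun x => norm_ne_zero_iff.2 (hne0 x))).smul hh
  · intro x
    have := norm_pos_iff.2 (hne0 x)
    rw [norm_smul, Real.norm_of_nonneg (by positivity)]
    field_simp
  · intro x hx
    have h1 : χ x = 0 := χ.zero_of_le_dist (by simp [hx, χ])
    have h2 : h x = x := by simp [h, h1]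
    rw [h2, hx]; norm_num

variable {ι : Type*} [Fintype ι]

theorem exists_continuous_retraction_stdSimplex [Nonempty ι] : ∃ ρ : (ι → ℝ) → ι → ℝ,
    Continuous ρ ∧ (∀ x, ρ x ∈ stdSimplex ℝ ι) ∧ ∀ x ∈ stdSimplex ℝ ι, ρ x = x := by
  set s : (ι → ℝ) → ℝ := fun x => ∑ i, max (x i) 0
  have hs : Continuous s := by fun_prop
  have hpos : ∀ x, 0 < max (s x) 1 := fun x => lt_max_of_lt_right one_pos
  -- Take positive parts; if their sum is below `1`, share the deficit equally among the
  -- coordinates, and if it exceeds `1`, divide by it.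
  refine ⟨fun x i => (max (x i) 0 + max (1 - s x) 0 / Fintype.card ι) / max (s x) 1, ?_, ?_, ?_⟩
  · refine continuous_pi fun i => Continuous.div (by fun_prop) (by fun_prop) fun x => (hpos x).ne'
  · refine fun x => ⟨fun i => div_nonneg (by positivity) (hpos x).le, ?_⟩
    rw [← Finset.sum_div, div_eq_one_iff_eq (hpos x).ne', Finset.sum_add_distrib, Finset.sum_const,
      Finset.card_univ, nsmul_eq_mul, mul_div_cancel₀ _ (by simp)]
    rcases le_total (s x) 1 with h | h
    · rw [max_eq_right h, max_eq_left (by linarith)]; simp [s]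
    · rw [max_eq_left h, max_eq_right (by linarith)]; simp [s]
  · intro x hx
    have h1 : s x = 1 := by
      rw [← hx.2]; exact Finset.sum_congr rfl fun i _ => max_eq_left (hx.1 i)
    ext i
    simp [h1, hx.1 i]

/-- Brouwer's fixed point theorem on the standard simplex. -/
theorem exists_fixedPoint_stdSimplex [Nonempty ι] {f : (ι → ℝ) → ι → ℝ}
    (hf : ContinuousOn f (stdSimplex ℝ ι)) (hmaps : MapsTo f (stdSimplex ℝ ι) (stdSimplex ℝ ι)) :
    ∃ x ∈ stdSimplex ℝ ι, f x = x := by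
  obtain ⟨ρ, hρ, hρm, hρid⟩ := exists_continuous_retraction_stdSimplex (ι := ι)
  set F : EuclideanSpace ℝ ι → EuclideanSpace ℝ ι := fun x => WithLp.toLp 2 (f (ρ x.ofLp))
  have hF : Continuous F := by
    refine (PiLp.continuous_toLp 2 _).comp ?_
    exact hf.comp_continuous (hρ.comp (PiLp.continuous_ofLp 2 _)) fun x => hρm _
  obtain ⟨x, hx⟩ := exists_fixedPoint_of_norm_le_one hF fun x => by
    have hm := hmaps (hρm x.ofLp)
    rw [EuclideanSpace.norm_eq, Real.sqrt_le_one]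
    simp only [F, Real.norm_eq_abs, sq_abs]
    rw [← hm.2]
    refine Finset.sum_le_sum fun i hi => ?_
    have h0 := hm.1 i
    have h1 : f (ρ x.ofLp) i ≤ 1 := hm.2 ▸ Finset.single_le_sum (fun j _ => hm.1 j) hi
    nlinarith
  have hx' : f (ρ x.ofLp) = x.ofLp := congrArg WithLp.ofLp hx
  have hxm : x.ofLp ∈ stdSimplex ℝ ι := hx' ▸ hmaps (hρm _)
  exact ⟨x.ofLp, hxm, by rwa [hρid _ hxm] at hx'⟩

end Brouwer

/-! ### Ky Fan's inequality, Nash equilibria and closed images of convex sets. -/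

/-- Ky Fan's inequality. -/
theorem exists_forall_nonneg_of_convexOn {F : Type*} [AddCommGroup F] [Module ℝ F]
    [TopologicalSpace F] [IsTopologicalAddGroup F] [ContinuousSMul ℝ F] {X : Set F}
    (hX : IsCompact X) (hne : X.Nonempty) {φ : F → F → ℝ}
    (hcont : ∀ y ∈ X, ContinuousOn (fun x => φ x y) X) (hconv : ∀ x ∈ X, ConvexOn ℝ X (φ x))
    (hdiag : ∀ x ∈ X, 0 ≤ φ x x) : ∃ x ∈ X, ∀ y ∈ X, 0 ≤ φ x y := by
  by_contra! H
  choose! Y hYX hY using H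
  have hnhds : ∀ x ∈ X, {z | φ z (Y x) < 0} ∈ 𝓝[X] x := fun x hx =>
    (hcont (Y x) (hYX x hx) x hx).eventually (gt_mem_nhds (hY x hx))
  obtain ⟨s, hsX, hs⟩ := hX.elim_nhdsWithin_subcover _ hnhds
  obtain ⟨x₀, hx₀⟩ := hne
  have : Nonempty s := by
    obtain ⟨i, hi, -⟩ := mem_iUnion₂.1 (hs hx₀)
    exact ⟨⟨i, hi⟩⟩
  have hXc : Convex ℝ X := (hconv x₀ hx₀).1
  have hYs : ∀ i : s, Y i ∈ X := fun i => hYX _ (hsX i i.2)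
  set p : (s → ℝ) → F := fun t => ∑ i, t i • Y i
  have hp : Continuous p := by fun_prop
  have hpX : MapsTo p (stdSimplex ℝ s) X := fun t ht =>
    hXc.sum_mem (fun i _ => ht.1 i) ht.2 fun i _ => hYs i
  -- A fixed point of the normalised weights is a convex combination `z` of the `Y i` that charges
  -- only those `i` with `φ z (Y i) < 0`. Convexity then gives `φ z z < 0`, against `hdiag`.
  set β : s → F → ℝ := fun i z => max 0 (-φ z (Y i))
  have hβ : ∀ i, ContinuousOn (fun t => β i (p t)) (stdSimplex ℝ s) := fun i =>
    continuousOn_const.sup ((hcont _ (hYs i)).comp hp.continuousOn hpX).neg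
  have hβ0 : ∀ i z, 0 ≤ β i z := fun i z => le_max_left _ _
  have hβpos : ∀ z ∈ X, 0 < ∑ i, β i z := by
    intro z hz
    obtain ⟨i, hi, hzi⟩ := mem_iUnion₂.1 (hs hz)
    refine Finset.sum_pos' (fun i _ => hβ0 i z) ⟨⟨i, hi⟩, Finset.mem_univ _, ?_⟩
    exact lt_max_of_lt_right (neg_pos.2 hzi)
  obtain ⟨t, ht, hfix⟩ := exists_fixedPoint_stdSimplex
    (f := fun t i => β i (p t) / ∑ j, β j (p t))
    (continuousOn_pi.2 fun i => (hβ i).div (continuousOn_finsetSum _ fun j _ => hβ j)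
      fun t ht => (hβpos _ (hpX ht)).ne')
    (fun t ht => ⟨fun i => div_nonneg (hβ0 _ _) (hβpos _ (hpX ht)).le, by
      rw [← Finset.sum_div, div_self (hβpos _ (hpX ht)).ne']⟩)
  have hz := hpX ht
  set z := p t
  have hle : φ z z ≤ ∑ i, t i * φ z (Y i) :=
    (hconv z hz).map_sum_le (fun i _ => ht.1 i) ht.2 fun i _ => hYs i
  have hneg : ∀ i, t i * φ z (Y i) ≤ 0 ∧ (0 < β i z → t i * φ z (Y i) < 0) := by
    intro i
    have hti : t i = β i z / ∑ j, β j z := (congrFun hfix i).symm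
    rcases le_or_gt 0 (φ z (Y i)) with h | h
    · have h0 : β i z = 0 := max_eq_left (by linarith)
      rw [hti, h0]; simp
    · refine ⟨mul_nonpos_of_nonneg_of_nonpos (ht.1 i) h.le, fun h0 => ?_⟩
      rw [hti]
      exact mul_neg_of_pos_of_neg (div_pos h0 (hβpos z hz)) h
  obtain ⟨i, -, hi⟩ := Finset.exists_lt_of_sum_lt (s := Finset.univ) (f := fun _ : s => (0 : ℝ))
    (g := fun i => β i z) (by simpa using hβpos z hz)
  have := Finset.sum_neg' (s := Finset.univ) (fun i _ => (hneg i).1) ⟨i, Finset.mem_univ _, (hneg i).2 hi⟩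
  linarith [hdiag z hz]

/-- Existence of a Nash equilibrium for convex continuous costs of the sum of the strategies. -/
theorem exists_nash_of_convexOn {F : Type*} [AddCommGroup F] [Module ℝ F]
    [TopologicalSpace F] [IsTopologicalAddGroup F] [ContinuousSMul ℝ F] {X₁ X₂ : Set F}
    (hX₁ : IsCompact X₁) (hX₂ : IsCompact X₂) (hc₁ : Convex ℝ X₁) (hc₂ : Convex ℝ X₂)
    (hne₁ : X₁.Nonempty) (hne₂ : X₂.Nonempty) {J₁ J₂ : F → ℝ} (hJ₁ : Continuous J₁)
    (hJ₂ : Continuous J₂) (hJc₁ : ConvexOn ℝ univ J₁) (hJc₂ : ConvexOn ℝ univ J₂) :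
    ∃ x₁ ∈ X₁, ∃ x₂ ∈ X₂, (∀ z ∈ X₁, J₁ (x₁ + x₂) ≤ J₁ (z + x₂)) ∧
      ∀ z ∈ X₂, J₂ (x₁ + x₂) ≤ J₂ (x₁ + z) := by
  have hconv : ∀ {J : F → ℝ} (_ : ConvexOn ℝ univ J) (c : F) (l : F × F →ₗ[ℝ] F),
      ConvexOn ℝ (X₁ ×ˢ X₂) fun y => J (c + l y) := fun hJ c l =>
    ((hJ.translate_right c).comp_linearMap l).subset (subset_univ _) (hc₁.prod hc₂)
  obtain ⟨⟨x₁, x₂⟩, ⟨h₁, h₂⟩, h⟩ := exists_forall_nonneg_of_convexOn (F := F × F)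
    -- The Nikaido–Isoda function: the total change of cost when each player deviates alone from `x`
    -- to `y`. Deviations of a single player recover the two Nash inequalities.
    (φ := fun x y => (J₁ (x.2 + y.1) + -J₁ (x.1 + x.2)) + (J₂ (x.1 + y.2) + -J₂ (x.1 + x.2)))
    (hX₁.prod hX₂) (hne₁.prod hne₂) (fun y _ => by fun_prop)
    (fun x _ => ((hconv hJc₁ x.2 (LinearMap.fst ℝ F F)).add_const _).add
      ((hconv hJc₂ x.1 (LinearMap.snd ℝ F F)).add_const _))
    (fun x _ => by simp [add_comm])
  refine ⟨x₁, h₁, x₂, h₂, fun z hz => ?_, fun z hz => ?_⟩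
  · have := h (z, x₂) ⟨hz, h₂⟩
    simp only at this
    rw [add_comm z]
    linarith
  · have := h (x₁, z) ⟨h₁, hz⟩
    simp only [add_comm x₂ x₁] at this
    linarith

/-- In a Hilbert space, a continuous linear map sends bounded closed convex sets to closed sets. -/
theorem isClosed_image_of_isBounded {W H : Type*} [NormedAddCommGroup W] [InnerProductSpace ℝ W]
    [CompleteSpace W] [NormedAddCommGroup H] [InnerProductSpace ℝ H] [CompleteSpace H]
    (L : W →L[ℝ] H) {U : Set W}
    (hc : Convex ℝ U) (hcl : IsClosed U) (hb : Bornology.IsBounded U) : IsClosed (L '' U) := by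
  rw [← closure_subset_iff_isClosed]
  intro x hx
  rw [mem_closure_iff_seq_limit] at hx
  obtain ⟨w, hw, hlim⟩ := hx
  choose u huU huw using hw
  obtain ⟨M, hM⟩ := hb.exists_norm_le
  set D : W ≃ₗᵢ⋆[ℝ] StrongDual ℝ W := InnerProductSpace.toDual ℝ W
  -- By Banach–Alaoglu and the Riesz isomorphism, the preimages `u n` have a weak cluster point `v`.
  have hcomp := WeakDual.isCompact_closedBall (𝕜 := ℝ) (E := W) 0 M
  obtain ⟨ℓ, -, hℓ⟩ := hcomp.exists_mapClusterPt (f := atTop)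
    (u := fun n => StrongDual.toWeakDual (D (u n)))
    (by
      refine tendsto_principal.2 (Eventually.of_forall fun n => ?_)
      simpa using hM _ (huU n))
  set v : W := D.symm (WeakDual.toStrongDual ℓ)
  have hclus : ∀ y, MapClusterPt (inner ℝ v y) atTop fun n => inner ℝ (u n) y := by
    intro y
    have h := hℓ.continuousAt_comp ((WeakDual.eval_continuous y).continuousAt)
    have h1 : ℓ y = inner ℝ v y := by
      rw [← InnerProductSpace.toDual_apply_apply]
      change _ = D (D.symm _) y
      rw [D.apply_symm_apply]; rfl
    rw [← h1]
    exact h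
  have hLv : L v = x := by
    refine ext_inner_right ℝ fun y => ?_
    have h1 := hclus (ContinuousLinearMap.adjoint L y)
    simp_rw [ContinuousLinearMap.adjoint_inner_right, huw] at h1
    have h2 : Tendsto (fun n => inner ℝ (w n) y) atTop (𝓝 (inner ℝ x y)) :=
      hlim.inner tendsto_const_nhds
    have h3 : ClusterPt (inner ℝ (L v) y) (𝓝 (inner ℝ x y)) := ClusterPt.mono h1 h2
    exact (eq_of_nhds_neBot h3)
  refine ⟨v, ?_, hLv⟩
  -- A closed convex set contains its weak cluster points: otherwise Hahn–Banach separates `v`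
  -- strictly from `U`.
  by_contra hv
  obtain ⟨f, s, hfs, hsv⟩ := geometric_hahn_banach_closed_point hc hcl hv
  have h1 := hclus (D.symm f)
  have h2 : ∀ z, inner ℝ z (D.symm f) = f z := fun z => by
    rw [real_inner_comm, ← InnerProductSpace.toDual_apply_apply]
    change D (D.symm f) z = _
    rw [D.apply_symm_apply]
  simp_rw [h2] at h1
  have h3 : f v ≤ s := by
    by_contra! hlt
    obtain ⟨n, hn⟩ := (h1.frequently (lt_mem_nhds hlt)).exists
    exact absurd hn (not_lt.2 (hfs _ (huU n)).le)
  linarith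

/-! ### The scalar linear equation with integrable source. -/

section Scalar

variable {T lam a : ℝ} {f y : ℝ → ℝ}

/-- The explicit solution of `y' = -lam y + f`, `y 0 = a`. -/
noncomputable def duhamel (lam a : ℝ) (f : ℝ → ℝ) (t : ℝ) : ℝ :=
  Real.exp (-lam * t) * (a + ∫ s in 0..t, Real.exp (lam * s) * f s)

theorem intervalIntegrable_exp_mul (hf : IntervalIntegrable f volume 0 T) :
    IntervalIntegrable (fun s => Real.exp (lam * s) * f s) volume 0 T :=
  hf.continuousOn_mul (by fun_prop)

theorem absolutelyContinuousOnInterval_duhamel (hf : IntervalIntegrable f volume 0 T) :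
    AbsolutelyContinuousOnInterval (duhamel lam a f) 0 T := by
  have h1 : AbsolutelyContinuousOnInterval (fun t => Real.exp (-lam * t)) 0 T :=
    ContDiffOn.absolutelyContinuousOnInterval (by fun_prop)
  have h2 : AbsolutelyContinuousOnInterval (fun _ => a) 0 T :=
    ContDiffOn.absolutelyContinuousOnInterval (by fun_prop)
  have h3 := (intervalIntegrable_exp_mul (lam := lam) hf).absolutelyContinuousOnInterval_intervalIntegral
    (c := 0) left_mem_uIcc
  exact h1.mul (h2.add h3)

theorem duhamel_eq_add_integral (hf : IntervalIntegrable f volume 0 T) {t : ℝ}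
    (ht : t ∈ Icc 0 T) :
    duhamel lam a f t = a + ∫ s in 0..t, (-lam * duhamel lam a f s + f s) := by
  have hsub : uIcc 0 t ⊆ uIcc 0 T := uIcc_subset_uIcc_left
    (by rw [uIcc_of_le (ht.1.trans ht.2)]; exact ht)
  have hac := (absolutelyContinuousOnInterval_duhamel (lam := lam) (a := a) hf).mono hsub
  have h0 : duhamel lam a f 0 = a := by simp [duhamel]
  have h := hac.integral_deriv_eq_sub
  rw [h0] at h
  -- The source is only integrable, so the equation holds almost everywhere; absolute continuity
  -- lets it be integrated.
  rw [eq_comm, ← eq_sub_iff_add_eq', ← h]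
  refine intervalIntegral.integral_congr_ae ?_
  have hi := (intervalIntegrable_exp_mul (lam := lam) hf).mono_set hsub
  filter_upwards [hi.ae_hasDerivAt_integral] with s hs hst
  have hs := hs (uIoc_subset_uIcc hst) 0 left_mem_uIcc
  have h1 : HasDerivAt (fun t => Real.exp (-lam * t)) (Real.exp (-lam * s) * (-lam * 1)) s :=
    ((hasDerivAt_id s).const_mul (-lam)).exp
  have h2 := h1.mul (hs.const_add a)
  rw [show deriv (duhamel lam a f) s = _ from h2.deriv]
  simp only [duhamel]
  have h3 : Real.exp (-lam * s) * (Real.exp (lam * s) * f s) = f s := by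
    rw [← mul_assoc, ← Real.exp_add]; simp
  rw [h3]; ring

/-- Integrate `(y²)' = 2 y (-lam y + f) ≤ -lam y² + lam⁻¹ f²`. The weights are chosen so that with
`lam = κᵢ⁻¹` the source enters with the factor `κᵢ`, which yields the smoothing estimate at the
final time. -/
theorem energy_le (hlam : 0 < lam) (hf : IntervalIntegrable f volume 0 T)
    (hf2 : IntervalIntegrable (fun s => f s ^ 2) volume 0 T) (hy : ContinuousOn y (Icc 0 T))
    (heq : ∀ t ∈ Icc 0 T, y t = a + ∫ s in 0..t, (-lam * y s + f s)) {t : ℝ} (ht : t ∈ Icc 0 T) :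
    y t ^ 2 + lam * ∫ s in 0..t, y s ^ 2 ≤ a ^ 2 + lam⁻¹ * ∫ s in 0..t, f s ^ 2 := by
  have hsub : uIcc 0 t ⊆ uIcc 0 T := uIcc_subset_uIcc_left
    (by rw [uIcc_of_le (ht.1.trans ht.2)]; exact ht)
  have hIcc : uIcc 0 T = Icc 0 T := uIcc_of_le (ht.1.trans ht.2)
  have hyt : ContinuousOn y (uIcc 0 t) := hy.mono (hIcc ▸ hsub)
  have hft := hf.mono_set hsub
  have hf2t := hf2.mono_set hsub
  have hg : IntervalIntegrable (fun s => -lam * y s + f s) volume 0 t :=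
    (ContinuousOn.intervalIntegrable (by fun_prop)).add hft
  have hac : AbsolutelyContinuousOnInterval (fun t => a + ∫ s in 0..t, (-lam * y s + f s)) 0 t :=
    (ContDiffOn.absolutelyContinuousOnInterval (f := fun _ => a) (by fun_prop)).add
      (hg.absolutelyContinuousOnInterval_intervalIntegral left_mem_uIcc)
  set z : ℝ → ℝ := fun t => a + ∫ s in 0..t, (-lam * y s + f s)
  have hzy : ∀ s ∈ uIcc 0 t, z s = y s := fun s hs => (heq s (hIcc ▸ hsub hs)).symm
  have h := (hac.mul hac).integral_deriv_eq_sub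
  have hz0 : z 0 = a := by simp [z]
  have h1 : ∫ s in 0..t, deriv (z * z) s = ∫ s in 0..t, 2 * y s * (-lam * y s + f s) := by
    refine intervalIntegral.integral_congr_ae ?_
    filter_upwards [hg.ae_hasDerivAt_integral] with s hs hst
    have hs' := hs (uIoc_subset_uIcc hst) 0 left_mem_uIcc
    have h2 : HasDerivAt z (-lam * y s + f s) s := hs'.const_add a
    rw [(h2.mul h2).deriv, hzy s (uIoc_subset_uIcc hst)]; ring
  rw [h1] at h
  simp only [Pi.mul_apply, hz0, hzy t right_mem_uIcc] at h
  have hy2 : IntervalIntegrable (fun s => y s ^ 2) volume 0 t :=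
    ContinuousOn.intervalIntegrable (by fun_prop)
  have h3 : ∫ s in 0..t, 2 * y s * (-lam * y s + f s) ≤
      ∫ s in 0..t, (-lam * y s ^ 2 + lam⁻¹ * f s ^ 2) := by
    refine intervalIntegral.integral_mono_on ht.1 (hg.continuousOn_mul (by fun_prop))
      ((hy2.const_mul _).add (hf2t.const_mul _)) fun s _ => ?_
    have h4 : 0 ≤ lam⁻¹ * (lam * y s - f s) ^ 2 := by positivity
    have h5 : lam⁻¹ * (lam * y s - f s) ^ 2 = lam * y s ^ 2 - 2 * y s * f s + lam⁻¹ * f s ^ 2 := by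
      field_simp; ring
    nlinarith
  rw [intervalIntegral.integral_add (hy2.const_mul _) (hf2t.const_mul _),
    intervalIntegral.integral_const_mul, intervalIntegral.integral_const_mul] at h3
  nlinarith

theorem eq_zero_of_eq_neg_integral (hlam : 0 < lam) (hy : ContinuousOn y (Icc 0 T))
    (heq : ∀ t ∈ Icc 0 T, y t = ∫ s in 0..t, -lam * y s) {t : ℝ} (ht : t ∈ Icc 0 T) : y t = 0 := by
  have h := energy_le (f := fun _ => 0) (a := 0) hlam (by simp) (by simp) hy
    (by simpa using heq) ht
  have h1 : 0 ≤ ∫ s in 0..t, y s ^ 2 := intervalIntegral.integral_nonneg ht.1 fun s _ => sq_nonneg _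
  simp at h
  have h2 : y t ^ 2 ≤ 0 := by nlinarith
  exact pow_eq_zero_iff two_ne_zero |>.1 (le_antisymm h2 (sq_nonneg _))

end Scalar
-- The evolution equation in an eigenbasis.
section Abstract

variable {H : Type*} [NormedAddCommGroup H] [InnerProductSpace ℝ H]
  {ι : Type*} (b : HilbertBasis ι ℝ H)

theorem hasSum_inner_sq (v : H) : HasSum (fun i => inner ℝ (b i) v ^ 2) (‖v‖ ^ 2) := by
  have h := b.hasSum_inner_mul_inner v v
  rw [real_inner_self_eq_norm_sq] at h
  simpa only [real_inner_comm, ← sq] using h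

theorem exists_inner_eq_of_summable_sq {c : ι → ℝ} (hc : Summable fun i => c i ^ 2) :
    ∃ v : H, ∀ i, inner ℝ (b i) v = c i := by
  refine ⟨b.repr.symm ⟨c, ?_⟩, fun i => ?_⟩
  · refine memℓp_gen ?_
    simpa using hc
  · rw [← b.repr_apply_apply, LinearIsometryEquiv.apply_symm_apply]

variable {b} {κ : ι → ℝ} {T : ℝ} {y₀ : H} {f : ℝ → H}

theorem ext_inner_basis {v w : H} (h : ∀ i, inner ℝ (b i) v = inner ℝ (b i) w) : v = w := by
  refine b.repr.injective ?_
  ext i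
  rw [b.repr_apply_apply, b.repr_apply_apply, h]

theorem intervalIntegrable_of_memLp {T : ℝ} (hT : 0 ≤ T) {g : ℝ → ℝ}
    (hg : MemLp g 2 (volume.restrict (Ioo 0 T))) :
    IntervalIntegrable g volume 0 T ∧ IntervalIntegrable (fun s => g s ^ 2) volume 0 T := by
  rw [intervalIntegrable_iff_integrableOn_Ioo_of_le hT,
    intervalIntegrable_iff_integrableOn_Ioo_of_le hT]
  exact ⟨hg.integrable one_le_two, hg.integrable_sq⟩

theorem memLp_inner (hf : MemLp f 2 (volume.restrict (Ioo 0 T))) (v : H) :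
    MemLp (fun s => inner ℝ v (f s)) 2 (volume.restrict (Ioo 0 T)) := hf.const_inner v

/-- Bessel's inequality under the time integral. -/
theorem sum_integral_inner_sq_le (hT : 0 ≤ T) (hf : MemLp f 2 (volume.restrict (Ioo 0 T)))
    (F : Finset ι) : ∑ i ∈ F, ∫ s in 0..T, inner ℝ (b i) (f s) ^ 2 ≤
      ∫ s in Ioo 0 T, ‖f s‖ ^ 2 := by
  simp_rw [intervalIntegral.integral_of_le hT, integral_Ioc_eq_integral_Ioo]
  rw [← integral_finsetSum _ fun i _ => (memLp_inner hf (b i)).integrable_sq]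
  refine integral_mono (integrable_finsetSum _ fun i _ => (memLp_inner hf (b i)).integrable_sq)
    hf.integrable_norm_pow' fun s => ?_
  have := b.orthonormal.sum_inner_products_le (f s) (s := F)
  simpa using this

/-- The bound, over `[0,T]`, of the square of the `i`-th coordinate of the solution. -/
noncomputable def coordBound (b : HilbertBasis ι ℝ H) (κ : ι → ℝ) (T : ℝ) (y₀ : H) (f : ℝ → H)
    (i : ι) : ℝ :=
  inner ℝ (b i) y₀ ^ 2 + κ i * ∫ s in 0..T, inner ℝ (b i) (f s) ^ 2

theorem summable_integral_inner_sq (hT : 0 ≤ T) (hf : MemLp f 2 (volume.restrict (Ioo 0 T))) :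
    Summable fun i => ∫ s in 0..T, inner ℝ (b i) (f s) ^ 2 :=
  summable_of_sum_le (fun _ => intervalIntegral.integral_nonneg hT fun _ _ => sq_nonneg _)
    (sum_integral_inner_sq_le hT hf)

theorem summable_coordBound {κm : ℝ} (hκ : ∀ i, 0 < κ i) (hκm : ∀ i, κ i ≤ κm)
    (hT : 0 ≤ T) (hf : MemLp f 2 (volume.restrict (Ioo 0 T))) :
    Summable (coordBound b κ T y₀ f) := by
  refine (hasSum_inner_sq b y₀).summable.add ?_
  have h0 : ∀ i, 0 ≤ ∫ s in 0..T, inner ℝ (b i) (f s) ^ 2 := fun i =>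
    intervalIntegral.integral_nonneg hT fun s _ => sq_nonneg _
  exact ((summable_integral_inner_sq (b := b) hT hf).mul_left κm).of_nonneg_of_le
    (fun i => mul_nonneg (hκ i).le (h0 i)) fun i => mul_le_mul_of_nonneg_right (hκm i) (h0 i)

/-- `y` solves `κᵢ yᵢ' = -yᵢ + κᵢ fᵢ`, `yᵢ(0) = (y₀)ᵢ` in coordinates on `[0,T]`. -/
structure IsCoordSolution (b : HilbertBasis ι ℝ H) (κ : ι → ℝ) (T : ℝ) (y₀ : H) (f : ℝ → H)
    (y : ℝ → H) : Prop where
  continuousOn : ContinuousOn y (Icc 0 T)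
  equation : ∀ i, ∀ t ∈ Icc 0 T, inner ℝ (b i) (y t) =
    inner ℝ (b i) y₀ + ∫ s in 0..t, (-(κ i)⁻¹ * inner ℝ (b i) (y s) + inner ℝ (b i) (f s))

theorem IsCoordSolution.sq_add_integral_le {y : ℝ → H} (hy : IsCoordSolution b κ T y₀ f y)
    (hκ : ∀ i, 0 < κ i) (hf : MemLp f 2 (volume.restrict (Ioo 0 T))) (i : ι) {t : ℝ}
    (ht : t ∈ Icc 0 T) :
    inner ℝ (b i) (y t) ^ 2 + (κ i)⁻¹ * ∫ s in 0..t, inner ℝ (b i) (y s) ^ 2 ≤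
      inner ℝ (b i) y₀ ^ 2 + κ i * ∫ s in 0..t, inner ℝ (b i) (f s) ^ 2 := by
  obtain ⟨h1, h2⟩ := intervalIntegrable_of_memLp (ht.1.trans ht.2) (memLp_inner hf (b i))
  have h := energy_le (inv_pos.2 (hκ i)) h1 h2 (continuousOn_const.inner hy.continuousOn)
    (hy.equation i) ht
  rwa [inv_inv] at h

theorem IsCoordSolution.eqOn {y z : ℝ → H} (hy : IsCoordSolution b κ T y₀ f y)
    (hz : IsCoordSolution b κ T y₀ f z) (hκ : ∀ i, 0 < κ i)
    (hf : MemLp f 2 (volume.restrict (Ioo 0 T))) : EqOn z y (Icc 0 T) := by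
  intro t ht
  refine ext_inner_basis (b := b) fun i => sub_eq_zero.1 ?_
  have hT := ht.1.trans ht.2
  have hfi := (intervalIntegrable_of_memLp hT (memLp_inner hf (b i))).1
  have hyc : ContinuousOn (fun s => inner ℝ (b i) (y s)) (Icc 0 T) :=
    continuousOn_const.inner hy.continuousOn
  have hzc : ContinuousOn (fun s => inner ℝ (b i) (z s)) (Icc 0 T) :=
    continuousOn_const.inner hz.continuousOn
  refine eq_zero_of_eq_neg_integral (y := fun s => inner ℝ (b i) (z s) - inner ℝ (b i) (y s))
    (inv_pos.2 (hκ i)) (hzc.sub hyc) (fun s hs => ?_) ht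
  have hsub : uIcc 0 s ⊆ Icc 0 T := by
    rw [uIcc_of_le hs.1]; exact Icc_subset_Icc_right hs.2
  have hfs := hfi.mono_set (by rwa [uIcc_of_le hT] : uIcc 0 s ⊆ uIcc 0 T)
  have hi : ∀ {w : ℝ → ℝ}, ContinuousOn w (Icc 0 T) →
      IntervalIntegrable (fun s => -(κ i)⁻¹ * w s + inner ℝ (b i) (f s)) volume 0 s := fun hw =>
    ((hw.mono hsub).intervalIntegrable.const_mul _).add hfs
  simp only [hy.equation i s hs, hz.equation i s hs]
  rw [add_sub_add_left_eq_sub, ← intervalIntegral.integral_sub (hi hzc) (hi hyc)]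
  refine intervalIntegral.integral_congr fun r _ => ?_
  ring

theorem exists_isCoordSolution {κm : ℝ} (hκ : ∀ i, 0 < κ i) (hκm : ∀ i, κ i ≤ κm)
    (hT : 0 ≤ T) (hf : MemLp f 2 (volume.restrict (Ioo 0 T))) :
    ∃ y : ℝ → H, IsCoordSolution b κ T y₀ f y := by
  set c : ι → ℝ → ℝ := fun i => duhamel (κ i)⁻¹ (inner ℝ (b i) y₀) fun s => inner ℝ (b i) (f s)
  have hfi := fun i => intervalIntegrable_of_memLp hT (memLp_inner hf (b i))
  have hcc : ∀ i, ContinuousOn (c i) (Icc 0 T) := fun i => by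
    have := (absolutelyContinuousOnInterval_duhamel (lam := (κ i)⁻¹) (a := inner ℝ (b i) y₀)
      (hfi i).1).continuousOn
    rwa [uIcc_of_le hT] at this
  have hceq : ∀ i, ∀ t ∈ Icc 0 T, c i t = inner ℝ (b i) y₀ +
      ∫ s in 0..t, (-(κ i)⁻¹ * c i s + inner ℝ (b i) (f s)) := fun i t ht =>
    duhamel_eq_add_integral (hfi i).1 ht
  have hB := summable_coordBound (b := b) (y₀ := y₀) hκ hκm hT hf
  have hcB : ∀ i, ∀ t ∈ Icc 0 T, c i t ^ 2 ≤ coordBound b κ T y₀ f i := by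
    intro i t ht
    have h := energy_le (inv_pos.2 (hκ i)) (hfi i).1 (hfi i).2 (hcc i) (hceq i) ht
    rw [inv_inv] at h
    have h1 : 0 ≤ ∫ s in 0..t, c i s ^ 2 :=
      intervalIntegral.integral_nonneg ht.1 fun s _ => sq_nonneg _
    have h2 : ∫ s in 0..t, inner ℝ (b i) (f s) ^ 2 ≤ ∫ s in 0..T, inner ℝ (b i) (f s) ^ 2 :=
      intervalIntegral.integral_mono_interval le_rfl ht.1 ht.2
        (Eventually.of_forall fun s => sq_nonneg _) (hfi i).2
    have h3 := mul_nonneg (inv_pos.2 (hκ i)).le h1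
    have h4 := mul_le_mul_of_nonneg_left h2 (hκ i).le
    unfold coordBound
    linarith
  have hex : ∀ t, ∃ v : H, t ∈ Icc 0 T → ∀ i, inner ℝ (b i) v = c i t := by
    intro t
    by_cases ht : t ∈ Icc 0 T
    · obtain ⟨v, hv⟩ := exists_inner_eq_of_summable_sq b
        (hB.of_nonneg_of_le (fun i => sq_nonneg (c i t)) fun i => hcB i t ht)
      exact ⟨v, fun _ => hv⟩
    · exact ⟨0, fun h => absurd h ht⟩
  choose y hy using hex
  refine ⟨y, fun t ht => ?_, fun i t ht => ?_⟩
  · rw [ContinuousWithinAt, tendsto_iff_norm_sub_tendsto_zero]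
    -- Parseval reduces norm continuity to dominated convergence of a series; the majorant comes
    -- from `(p - r)² ≤ 2 p² + 2 r²` and the time-uniform coordinate bound.
    have h : Tendsto (fun s => ∑' i, (c i s - c i t) ^ 2) (𝓝[Icc 0 T] t) (𝓝 (∑' _ : ι, (0 : ℝ))) := by
      refine tendsto_tsum_of_dominated_convergence (hB.mul_left 4) (fun i => ?_) ?_
      · have h1 : Tendsto (fun s => (c i s - c i t) ^ 2) (𝓝[Icc 0 T] t)
          (𝓝 ((c i t - c i t) ^ 2)) := ((hcc i t ht).sub_const _).pow 2
        simpa using h1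
      · filter_upwards [self_mem_nhdsWithin] with s hs i
        rw [Real.norm_of_nonneg (sq_nonneg _)]
        nlinarith [hcB i s hs, hcB i t ht, sq_nonneg (c i s + c i t)]
    rw [tsum_zero] at h
    have h2 : Tendsto (fun s => ‖y s - y t‖ ^ 2) (𝓝[Icc 0 T] t) (𝓝 0) := by
      refine h.congr' ?_
      filter_upwards [self_mem_nhdsWithin] with s hs
      rw [← (hasSum_inner_sq b (y s - y t)).tsum_eq]
      simp_rw [inner_sub_right, hy s hs, hy t ht]
    have h3 := h2.sqrt
    simpa using h3
  · rw [hy t ht i, hceq i t ht]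
    congr 1
    refine intervalIntegral.integral_congr fun s hs => ?_
    rw [uIcc_of_le ht.1] at hs
    simp only [hy s ⟨hs.1, hs.2.trans ht.2⟩ i]

/-- This is the `L²(0,T;H¹_α)` bound: when the `κᵢ` are the eigenvalues of `C C†`, the inner sum, if
finite, is `‖q‖²` with `C q = y t`. -/
theorem IsCoordSolution.lintegral_tsum_lt_top [Countable ι] {κm : ℝ} {y : ℝ → H}
    (hy : IsCoordSolution b κ T y₀ f y)
    (hκ : ∀ i, 0 < κ i) (hκm : ∀ i, κ i ≤ κm) (hT : 0 ≤ T)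
    (hf : MemLp f 2 (volume.restrict (Ioo 0 T))) :
    ∫⁻ t in Ioo 0 T, ∑' i, ENNReal.ofReal ((κ i)⁻¹ * inner ℝ (b i) (y t) ^ 2) < ⊤ := by
  have hyc : ∀ i, ContinuousOn (fun s => (κ i)⁻¹ * inner ℝ (b i) (y s) ^ 2) (Icc 0 T) := fun i =>
    continuousOn_const.mul ((continuousOn_const.inner hy.continuousOn).pow 2)
  rw [lintegral_tsum fun i => (((hyc i).mono Ioo_subset_Icc_self).aemeasurable
    measurableSet_Ioo).ennreal_ofReal]
  have hB := summable_coordBound (b := b) (y₀ := y₀) hκ hκm hT hf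
  refine lt_of_le_of_lt (ENNReal.tsum_le_tsum fun i => ?_) hB.tsum_ofReal_lt_top
  rw [← ofReal_integral_eq_lintegral_ofReal
    (((hyc i).integrableOn_compact isCompact_Icc).mono_set Ioo_subset_Icc_self)
    (Eventually.of_forall fun s => mul_nonneg (inv_pos.2 (hκ i)).le (sq_nonneg _))]
  refine ENNReal.ofReal_le_ofReal ?_
  rw [← integral_Ioc_eq_integral_Ioo, ← intervalIntegral.integral_of_le hT,
    intervalIntegral.integral_const_mul]
  have := hy.sq_add_integral_le hκ hf i (right_mem_Icc.2 hT)
  unfold coordBound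
  nlinarith [sq_nonneg (inner ℝ (b i) (y T))]

/-- The smoothing effect behind compactness: a source in `L²(0,T;H)` leads from `0` to a state in
the range of `C`, with a bound. -/
theorem IsCoordSolution.sum_final_le {y : ℝ → H} (hy : IsCoordSolution b κ T 0 f y)
    (hκ : ∀ i, 0 < κ i) (hT : 0 ≤ T) (hf : MemLp f 2 (volume.restrict (Ioo 0 T)))
    (F : Finset ι) :
    ∑ i ∈ F, (κ i)⁻¹ * inner ℝ (b i) (y T) ^ 2 ≤ ∫ s in Ioo 0 T, ‖f s‖ ^ 2 := by
  refine (Finset.sum_le_sum fun i _ => ?_).trans (sum_integral_inner_sq_le (b := b) hT hf F)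
  have h := hy.sq_add_integral_le hκ hf i (right_mem_Icc.2 hT)
  have h1 : 0 ≤ ∫ s in 0..T, inner ℝ (b i) (y s) ^ 2 :=
    intervalIntegral.integral_nonneg hT fun s _ => sq_nonneg _
  have h3 := mul_nonneg (inv_pos.2 (hκ i)).le h1
  rw [inv_mul_le_iff₀ (hκ i)]
  simp at h
  linarith

theorem IsCoordSolution.add {y y' : ℝ → H} {y₀' : H} {f' : ℝ → H}
    (hy : IsCoordSolution b κ T y₀ f y) (hy' : IsCoordSolution b κ T y₀' f' y')
    (hf : MemLp f 2 (volume.restrict (Ioo 0 T))) (hf' : MemLp f' 2 (volume.restrict (Ioo 0 T))) :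
    IsCoordSolution b κ T (y₀ + y₀') (f + f') (y + y') := by
  refine ⟨hy.continuousOn.add hy'.continuousOn, fun i t ht => ?_⟩
  have hT := ht.1.trans ht.2
  have hsub : uIcc 0 t ⊆ Icc 0 T := by
    rw [uIcc_of_le ht.1]; exact Icc_subset_Icc_right ht.2
  have hi : ∀ {w g : ℝ → H}, ContinuousOn w (Icc 0 T) → MemLp g 2 (volume.restrict (Ioo 0 T)) →
      IntervalIntegrable (fun s => -(κ i)⁻¹ * inner ℝ (b i) (w s) + inner ℝ (b i) (g s))
        volume 0 t := fun hw hg =>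
    (((continuousOn_const.inner hw).mono hsub).intervalIntegrable.const_mul _).add
      ((intervalIntegrable_of_memLp hT (memLp_inner hg (b i))).1.mono_set
        (by rwa [uIcc_of_le hT] : uIcc 0 t ⊆ uIcc 0 T))
  simp only [Pi.add_apply, inner_add_right]
  rw [hy.equation i t ht, hy'.equation i t ht, add_add_add_comm,
    ← intervalIntegral.integral_add (hi hy.continuousOn hf) (hi hy'.continuousOn hf')]
  congr 1
  refine intervalIntegral.integral_congr fun s _ => ?_
  ring

theorem IsCoordSolution.smul {y : ℝ → H} (c : ℝ) (hy : IsCoordSolution b κ T y₀ f y) :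
    IsCoordSolution b κ T (c • y₀) (c • f) (c • y) := by
  refine ⟨hy.continuousOn.const_smul c, fun i t ht => ?_⟩
  simp only [Pi.smul_apply, inner_smul_right]
  rw [hy.equation i t ht, mul_add, ← intervalIntegral.integral_const_mul]
  congr 1
  refine intervalIntegral.integral_congr fun s _ => ?_
  ring

theorem IsCoordSolution.congr {y : ℝ → H} {g : ℝ → H} (hy : IsCoordSolution b κ T y₀ f y)
    (hfg : f =ᵐ[volume.restrict (Ioo 0 T)] g) : IsCoordSolution b κ T y₀ g y := by
  refine ⟨hy.continuousOn, fun i t ht => ?_⟩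
  rw [hy.equation i t ht]
  congr 1
  rw [intervalIntegral.integral_of_le ht.1, intervalIntegral.integral_of_le ht.1,
    integral_Ioc_eq_integral_Ioo, integral_Ioc_eq_integral_Ioo]
  refine integral_congr_ae ?_
  filter_upwards [ae_restrict_of_ae_restrict_of_subset (Ioo_subset_Ioo_right ht.2) hfg] with s hs
  rw [hs]

end Abstract
-- Compact convex reachable sets and the abstract game.
section Abstract

variable {H : Type*} [NormedAddCommGroup H] [InnerProductSpace ℝ H]
  {ι : Type*} {b : HilbertBasis ι ℝ H} {κ : ι → ℝ} {T : ℝ}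

/-- Vectors with `∑ κᵢ⁻¹ yᵢ² < ∞` are in the range of `C`, if `C C†` is diagonal with
entries `κᵢ`. -/
theorem exists_eq_of_summable_inv_mul_sq [CompleteSpace H] {C : H →L[ℝ] H} (hκ : ∀ i, 0 < κ i)
    (hC : ∀ i, C (ContinuousLinearMap.adjoint C (b i)) = κ i • b i) {y : H}
    (hy : Summable fun i => (κ i)⁻¹ * inner ℝ (b i) y ^ 2) :
    ∃ q, C q = y ∧ ‖q‖ ^ 2 = ∑' i, (κ i)⁻¹ * inner ℝ (b i) y ^ 2 := by
  classical
  -- Singular vectors: `e` is orthonormal because `⟨C† bᵢ, C† bⱼ⟩ = ⟨bᵢ, C C† bⱼ⟩`, and `C (e i) =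
  -- √κᵢ bᵢ`. So `q = ∑ κᵢ^{-1/2} yᵢ eᵢ` is the wanted preimage.
  set e : ι → H := fun i => (Real.sqrt (κ i))⁻¹ • ContinuousLinearMap.adjoint C (b i)
  have hsq : ∀ i, 0 < Real.sqrt (κ i) := fun i => Real.sqrt_pos.2 (hκ i)
  have he : Orthonormal ℝ e := by
    rw [orthonormal_iff_ite]
    intro i j
    have hb := orthonormal_iff_ite.1 b.orthonormal i j
    simp only [e, inner_smul_left, inner_smul_right, ContinuousLinearMap.adjoint_inner_left, hC, hb]
    split_ifs with h
    · subst h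
      have := Real.mul_self_sqrt (hκ i).le
      have := hsq i
      simp
      field_simp
      rw [Real.sq_sqrt (hκ i).le]
    · simp
  set c : ι → ℝ := fun i => (Real.sqrt (κ i))⁻¹ * inner ℝ (b i) y
  have hc2 : ∀ i, c i ^ 2 = (κ i)⁻¹ * inner ℝ (b i) y ^ 2 := fun i => by
    rw [mul_pow, inv_pow, Real.sq_sqrt (hκ i).le]
  have hmem : Memℓp c 2 := memℓp_gen (by simpa [hc2] using hy)
  set V := he.orthogonalFamily
  set q : H := V.linearIsometry ⟨c, hmem⟩
  have hq : HasSum (fun i => c i • e i) q := by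
    simpa [LinearIsometry.toSpanSingleton_apply] using V.hasSum_linearIsometry ⟨c, hmem⟩
  refine ⟨q, ext_inner_basis (b := b) fun j => ?_, ?_⟩
  · have h1 : HasSum (fun i => inner ℝ (e j) (c i • e i)) (inner ℝ (e j) q) :=
      hq.mapL (innerSL ℝ (e j))
    have h2 : inner ℝ (e j) q = c j := by
      refine h1.unique ?_
      have h3 : (fun i => inner ℝ (e j) (c i • e i)) = fun i => if i = j then c j else 0 := by
        ext i
        rw [inner_smul_right, orthonormal_iff_ite.1 he]
        by_cases hij : i = j
        · simp [hij]
        · simp [hij, Ne.symm hij]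
      rw [h3]
      exact hasSum_ite_eq j (c j)
    simp only [e, c, inner_smul_left, ContinuousLinearMap.adjoint_inner_left] at h2
    exact mul_left_cancel₀ (inv_ne_zero (hsq j).ne') h2
  · rw [V.linearIsometry.norm_map, ← real_inner_self_eq_norm_sq, lp.inner_eq_tsum]
    refine tsum_congr fun i => ?_
    rw [← hc2]; simp [sq]

theorem norm_sq_eq_integral (f : Lp H 2 (volume.restrict (Ioo 0 T))) :
    ‖f‖ ^ 2 = ∫ s in Ioo 0 T, ‖f s‖ ^ 2 := by
  rw [← real_inner_self_eq_norm_sq, L2.inner_def]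
  simp_rw [real_inner_self_eq_norm_sq]

/-- The solution map from sources in `L²(0,T;H)` to final states, for zero initial data. -/
theorem exists_finalMap {κm : ℝ} (hκ : ∀ i, 0 < κ i) (hκm : ∀ i, κ i ≤ κm) (hT : 0 ≤ T) :
    ∃ L : Lp H 2 (volume.restrict (Ioo 0 T)) →L[ℝ] H,
      ∀ f : Lp H 2 (volume.restrict (Ioo 0 T)), ∃ y, IsCoordSolution b κ T 0 f y ∧ y T = L f := by
  have hmem := fun f : Lp H 2 (volume.restrict (Ioo 0 T)) => Lp.memLp f
  choose y hy using fun f : Lp H 2 (volume.restrict (Ioo 0 T)) =>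
    exists_isCoordSolution (b := b) (y₀ := (0 : H)) hκ hκm hT (hmem f)
  have hTm : T ∈ Icc 0 T := right_mem_Icc.2 hT
  let l : Lp H 2 (volume.restrict (Ioo 0 T)) →ₗ[ℝ] H :=
    { toFun := fun f => y f T
      map_add' := fun f g => by
        have h := (hy f).add (hy g) (hmem f) (hmem g)
        rw [add_zero] at h
        exact (h.congr (Lp.coeFn_add f g).symm).eqOn (hy (f + g)) hκ (hmem (f + g)) hTm
      map_smul' := fun c f => by
        have h := (hy f).smul c
        rw [smul_zero] at h
        exact (h.congr (Lp.coeFn_smul c f).symm).eqOn (hy (c • f)) hκ (hmem (c • f)) hTm }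
  refine ⟨l.mkContinuous (Real.sqrt (max κm 0)) fun f => ?_, fun f => ⟨y f, hy f, rfl⟩⟩
  have hs := (hy f).sum_final_le hκ hT (hmem f)
  rw [← norm_sq_eq_integral] at hs
  -- Each `κᵢ⁻¹` is at least `κm⁻¹`. The maximum with `0` covers an empty index set, where `κm` may
  -- be negative.
  have hsum : ‖y f T‖ ^ 2 ≤ max κm 0 * ‖f‖ ^ 2 := by
    refine hasSum_le_of_sum_le (hasSum_inner_sq b (y f T)) fun F => ?_
    have hκm0 : 0 ≤ max κm 0 := le_max_right _ _
    refine le_trans ?_ (mul_le_mul_of_nonneg_left (hs F) hκm0)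
    rw [Finset.mul_sum]
    refine Finset.sum_le_sum fun j _ => ?_
    have h1 : 1 ≤ max κm 0 * (κ j)⁻¹ := by
      rw [← div_eq_mul_inv, one_le_div (hκ j)]; exact (hκm j).trans (le_max_left _ _)
    rw [← mul_assoc]
    exact le_mul_of_one_le_left (sq_nonneg _) h1
  change ‖y f T‖ ≤ _
  rw [← Real.sqrt_sq (norm_nonneg f), ← Real.sqrt_mul' _ (sq_nonneg _)]
  exact Real.le_sqrt_of_sq_le hsum

/-- A sequence converging in `L²` has a subsequence converging almost everywhere. -/
theorem isClosed_setOf_ae_norm_le {α E : Type*} [MeasurableSpace α] {μ : Measure α}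
    [NormedAddCommGroup E] (M : ℝ) : IsClosed {u : Lp E 2 μ | ∀ᵐ t ∂μ, ‖u t‖ ≤ M} := by
  rw [← isSeqClosed_iff_isClosed]
  intro u v hu huv
  obtain ⟨ns, -, hns⟩ := (tendstoInMeasure_of_tendsto_Lp huv).exists_seq_tendsto_ae
  have h : ∀ᵐ t ∂μ, ∀ n, ‖u n t‖ ≤ M := ae_all_iff.2 hu
  filter_upwards [hns, h] with t ht1 ht2
  exact le_of_tendsto ht1.norm (Eventually.of_forall fun n => ht2 _)

theorem convex_setOf_ae_norm_le {α E : Type*} [MeasurableSpace α] {μ : Measure α}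
    [NormedAddCommGroup E] [NormedSpace ℝ E] (M : ℝ) :
    Convex ℝ {u : Lp E 2 μ | ∀ᵐ t ∂μ, ‖u t‖ ≤ M} := by
  intro u hu v hv r s hr hs hrs
  have hu : ∀ᵐ t ∂μ, ‖u t‖ ≤ M := hu
  have hv : ∀ᵐ t ∂μ, ‖v t‖ ≤ M := hv
  show ∀ᵐ t ∂μ, ‖(r • u + s • v : Lp E 2 μ) t‖ ≤ M
  filter_upwards [hu, hv, Lp.coeFn_add (r • u) (s • v), Lp.coeFn_smul r u, Lp.coeFn_smul s v]
    with t h1 h2 h3 h4 h5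
  rw [h3, Pi.add_apply, h4, h5, Pi.smul_apply, Pi.smul_apply]
  have := convex_closedBall (0 : E) M (mem_closedBall_zero_iff.2 h1) (mem_closedBall_zero_iff.2 h2)
    hr hs hrs
  exact mem_closedBall_zero_iff.1 this

theorem ae_norm_le_norm_of_Lp_top {α E : Type*} [MeasurableSpace α] {μ : Measure α}
    [NormedAddCommGroup E] (u : Lp E ⊤ μ) : ∀ᵐ t ∂μ, ‖u t‖ ≤ ‖u‖ := by
  have h1 : eLpNorm u ⊤ μ ≠ ⊤ := Lp.eLpNorm_ne_top u
  filter_upwards [enorm_ae_le_eLpNormEssSup u μ] with t ht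
  rw [Lp.norm_def, eLpNorm_exponent_top, ← toReal_enorm]
  rw [eLpNorm_exponent_top] at h1
  exact ENNReal.toReal_mono h1 ht

/-- The states reached at time `T` from `0` by sources `M₁ u` with `u` in a ball of
`L^∞(0,T;H)`. -/
def reachSet (b : HilbertBasis ι ℝ H) (κ : ι → ℝ) (T : ℝ) (M₁ : H →L[ℝ] H) (R : ℝ) : Set H :=
  {x | ∃ (u : Lp H ⊤ (volume.restrict (Ioo 0 T))) (y : ℝ → H), ‖u‖ ≤ R ∧
    IsCoordSolution b κ T 0 (fun t => M₁ (u t)) y ∧ y T = x}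

theorem memLp_comp_clm (M₁ : H →L[ℝ] H) (u : Lp H ⊤ (volume.restrict (Ioo 0 T))) :
    MemLp (fun t => M₁ (u t)) 2 (volume.restrict (Ioo 0 T)) :=
  M₁.comp_memLp' ((Lp.memLp u).mono_exponent le_top)

/-- On a bounded time interval the ball of `L^∞` is a bounded closed convex subset of `L²(0,T;H)`.
In this Hilbert space weak compactness is available. -/
theorem reachSet_eq_image {κm : ℝ} (hκ : ∀ i, 0 < κ i) (hκm : ∀ i, κ i ≤ κm) (hT : 0 ≤ T)
    (M₁ : H →L[ℝ] H) {R : ℝ} (hR : 0 ≤ R) :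
    ∃ L : Lp H 2 (volume.restrict (Ioo 0 T)) →L[ℝ] H,
      reachSet b κ T M₁ R =
        L '' {u : Lp H 2 (volume.restrict (Ioo 0 T)) | ∀ᵐ t ∂(volume.restrict (Ioo 0 T)),
          ‖u t‖ ≤ R} := by
  obtain ⟨L, hL⟩ := exists_finalMap (b := b) hκ hκm hT
  have hTm : T ∈ Icc 0 T := right_mem_Icc.2 hT
  refine ⟨L ∘L M₁.compLpL 2 (volume.restrict (Ioo 0 T)), ?_⟩
  ext x
  constructor
  · rintro ⟨u, y, hu, hy, rfl⟩
    have hu2 : MemLp u 2 (volume.restrict (Ioo 0 T)) := (Lp.memLp u).mono_exponent le_top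
    have hae := hu2.coeFn_toLp
    refine ⟨hu2.toLp u, ?_, ?_⟩
    · show ∀ᵐ t ∂(volume.restrict (Ioo 0 T)), ‖hu2.toLp u t‖ ≤ R
      filter_upwards [hae, ae_norm_le_norm_of_Lp_top u] with t h1 h2
      rw [h1]; exact h2.trans hu
    · obtain ⟨z, hz, hzL⟩ := hL (M₁.compLpL 2 (volume.restrict (Ioo 0 T)) (hu2.toLp u))
      have hcongr : (fun t => M₁ (u t)) =ᵐ[volume.restrict (Ioo 0 T)]
          M₁.compLpL 2 (volume.restrict (Ioo 0 T)) (hu2.toLp u) := by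
        filter_upwards [hae, M₁.coeFn_compLpL (p := 2) (hu2.toLp u)] with t h1 h2
        rw [h2, h1]
      refine hzL.symm.trans ?_
      exact (hy.congr hcongr).eqOn hz hκ (Lp.memLp _) hTm
  · rintro ⟨u, hu, rfl⟩
    have hu : ∀ᵐ t ∂(volume.restrict (Ioo 0 T)), ‖u t‖ ≤ R := hu
    have hut : MemLp u ⊤ (volume.restrict (Ioo 0 T)) :=
      memLp_top_of_bound (Lp.aestronglyMeasurable u) R hu
    obtain ⟨z, hz, hzL⟩ := hL (M₁.compLpL 2 (volume.restrict (Ioo 0 T)) u)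
    refine ⟨hut.toLp u, z, ?_, hz.congr ?_, hzL⟩
    · refine (Lp.norm_le_of_ae_bound hR (C := R) ?_).trans (by simp)
      filter_upwards [hut.coeFn_toLp, hu] with t h1 h2
      rw [h1]; exact h2
    · filter_upwards [hut.coeFn_toLp, M₁.coeFn_compLpL (p := 2) u] with t h1 h2
      rw [h2, h1]

theorem convex_reachSet {κm : ℝ} (hκ : ∀ i, 0 < κ i) (hκm : ∀ i, κ i ≤ κm) (hT : 0 ≤ T)
    (M₁ : H →L[ℝ] H) {R : ℝ} (hR : 0 ≤ R) : Convex ℝ (reachSet b κ T M₁ R) := by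
  obtain ⟨L, hL⟩ := reachSet_eq_image (b := b) hκ hκm hT M₁ hR
  rw [hL]
  exact (convex_setOf_ae_norm_le R).linear_image L.toLinearMap

theorem nonempty_reachSet {κm : ℝ} (hκ : ∀ i, 0 < κ i) (hκm : ∀ i, κ i ≤ κm) (hT : 0 ≤ T)
    (M₁ : H →L[ℝ] H) {R : ℝ} (hR : 0 ≤ R) : (reachSet b κ T M₁ R).Nonempty := by
  obtain ⟨y, hy⟩ := exists_isCoordSolution (b := b) (y₀ := 0) hκ hκm hT (memLp_comp_clm M₁ 0)
  exact ⟨y T, 0, y, by simpa using hR, hy, rfl⟩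

/-- The set is closed, as the image of a bounded closed convex set, and `sum_final_le` places it in
the image of a ball under the compact operator `C`. -/
theorem isCompact_reachSet [CompleteSpace H] {C : H →L[ℝ] H} (hCc : IsCompactOperator C)
    (hC : ∀ i, C (ContinuousLinearMap.adjoint C (b i)) = κ i • b i)
    {κm : ℝ} (hκ : ∀ i, 0 < κ i) (hκm : ∀ i, κ i ≤ κm) (hT : 0 ≤ T)
    (M₁ : H →L[ℝ] H) {R : ℝ} (hR : 0 ≤ R) : IsCompact (reachSet b κ T M₁ R) := by
  obtain ⟨L, hL⟩ := reachSet_eq_image (b := b) hκ hκm hT M₁ hR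
  have hclosed : IsClosed (reachSet b κ T M₁ R) := by
    rw [hL]
    exact isClosed_image_of_isBounded L (convex_setOf_ae_norm_le R) (isClosed_setOf_ae_norm_le R)
      (isBounded_iff_forall_norm_le.2 ⟨_, fun _ hu => Lp.norm_le_of_ae_bound hR hu⟩)
  have hsub : reachSet b κ T M₁ R ⊆ C '' Metric.closedBall 0 (Real.sqrt (T * (‖M₁‖ * R) ^ 2)) := by
    rintro x ⟨u, y, hu, hy, rfl⟩
    have hs := hy.sum_final_le hκ hT (memLp_comp_clm M₁ u)
    have hpos : ∀ i, 0 ≤ (κ i)⁻¹ * inner ℝ (b i) (y T) ^ 2 := fun i =>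
      mul_nonneg (inv_pos.2 (hκ i)).le (sq_nonneg _)
    have hsum := summable_of_sum_le hpos hs
    obtain ⟨q, hq, hqn⟩ := exists_eq_of_summable_inv_mul_sq hκ hC hsum
    refine ⟨q, ?_, hq⟩
    rw [mem_closedBall_zero_iff]
    refine Real.le_sqrt_of_sq_le ?_
    rw [hqn]
    refine (hsum.tsum_le_of_sum_le hs).trans ?_
    have hbound : ∀ᵐ s ∂(volume.restrict (Ioo 0 T)), ‖M₁ (u s)‖ ^ 2 ≤ (‖M₁‖ * R) ^ 2 := by
      filter_upwards [ae_norm_le_norm_of_Lp_top u] with s hs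
      have := M₁.le_opNorm_of_le (hs.trans hu)
      gcongr
    refine (integral_mono_ae (memLp_comp_clm M₁ u).integrable_norm_pow'
      (integrable_const ((‖M₁‖ * R) ^ 2)) hbound).trans ?_
    simp [hT]
  exact (hCc.isCompact_closure_image_closedBall _).of_isClosed_subset hclosed
    (hsub.trans subset_closure)

/-- Existence of a Nash equilibrium for the final states of coordinate solutions. -/
theorem exists_isNashEquilibrium [CompleteSpace H] {C : H →L[ℝ] H} (hCc : IsCompactOperator C)
    (hC : ∀ i, C (ContinuousLinearMap.adjoint C (b i)) = κ i • b i)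
    {κm : ℝ} (hκ : ∀ i, 0 < κ i) (hκm : ∀ i, κ i ≤ κm) (hT : 0 ≤ T)
    {M₀ M₁ M₂ : H →L[ℝ] H} {R₁ R₂ : ℝ} (hR₁ : 0 ≤ R₁) (hR₂ : 0 ≤ R₂) {y₀ : H}
    {g : Lp H ⊤ (volume.restrict (Ioo 0 T))}
    {y : Lp H ⊤ (volume.restrict (Ioo 0 T)) → Lp H ⊤ (volume.restrict (Ioo 0 T)) → ℝ → H}
    (hy : ∀ u₁ u₂, IsCoordSolution b κ T y₀
      (fun t => M₀ (g t) + M₁ (u₁ t) + M₂ (u₂ t)) (y u₁ u₂))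
    {J₁ J₂ : H → ℝ} (hJ₁ : Continuous J₁) (hJ₂ : Continuous J₂) (hJc₁ : ConvexOn ℝ univ J₁)
    (hJc₂ : ConvexOn ℝ univ J₂) :
    ∃ u₁ u₂, IsNashEquilibrium (fun v₁ v₂ => J₁ (y v₁ v₂ T)) (fun v₁ v₂ => J₂ (y v₁ v₂ T))
      {u | ‖u‖ ≤ R₁} {u | ‖u‖ ≤ R₂} u₁ u₂ := by
  have hTm : T ∈ Icc 0 T := right_mem_Icc.2 hT
  obtain ⟨yc, hyc⟩ := exists_isCoordSolution (b := b) (y₀ := y₀) hκ hκm hT (memLp_comp_clm M₀ g)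
  -- By superposition the costs depend only on the sum of the two reached states, so the game is
  -- played on the compact reachable sets instead of the control balls.
  have hadd : ∀ {u₁ u₂ : Lp H ⊤ (volume.restrict (Ioo 0 T))} {y₁ y₂ : ℝ → H},
      IsCoordSolution b κ T 0 (fun t => M₁ (u₁ t)) y₁ →
      IsCoordSolution b κ T 0 (fun t => M₂ (u₂ t)) y₂ → y u₁ u₂ T = yc T + (y₁ T + y₂ T) := by
    intro u₁ u₂ y₁ y₂ h₁ h₂
    have hm := ((memLp_comp_clm M₀ g).add (memLp_comp_clm M₁ u₁)).add (memLp_comp_clm M₂ u₂)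
    have h := (hyc.add h₁ (memLp_comp_clm M₀ g) (memLp_comp_clm M₁ u₁)).add h₂
      ((memLp_comp_clm M₀ g).add (memLp_comp_clm M₁ u₁)) (memLp_comp_clm M₂ u₂)
    rw [add_zero, add_zero] at h
    have h3 := h.eqOn (hy u₁ u₂) hκ hm hTm
    rw [h3, Pi.add_apply, Pi.add_apply, add_assoc]
  have hconv : ∀ {J : H → ℝ}, ConvexOn ℝ univ J → ConvexOn ℝ univ fun x => J (yc T + x) :=
    fun hJ => (hJ.translate_right (yc T)).subset (subset_univ _) convex_univ
  obtain ⟨x₁, ⟨u₁, y₁, hu₁, hy₁, rfl⟩, x₂, ⟨u₂, y₂, hu₂, hy₂, rfl⟩, h₁, h₂⟩ :=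
    exists_nash_of_convexOn
      (isCompact_reachSet hCc hC hκ hκm hT M₁ hR₁) (isCompact_reachSet hCc hC hκ hκm hT M₂ hR₂)
      (convex_reachSet hκ hκm hT M₁ hR₁) (convex_reachSet hκ hκm hT M₂ hR₂)
      (nonempty_reachSet hκ hκm hT M₁ hR₁) (nonempty_reachSet hκ hκm hT M₂ hR₂)
      (J₁ := fun x => J₁ (yc T + x)) (J₂ := fun x => J₂ (yc T + x))
      (by fun_prop) (by fun_prop) (hconv hJc₁) (hconv hJc₂)
  refine ⟨u₁, u₂, hu₁, hu₂, fun v₁ hv₁ => ?_, fun v₂ hv₂ => ?_⟩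
  · obtain ⟨z, hz⟩ := exists_isCoordSolution (b := b) (y₀ := 0) hκ hκm hT (memLp_comp_clm M₁ v₁)
    simp only [hadd hy₁ hy₂, hadd hz hy₂]
    exact h₁ _ ⟨v₁, z, hv₁, hz, rfl⟩
  · obtain ⟨z, hz⟩ := exists_isCoordSolution (b := b) (y₀ := 0) hκ hκm hT (memLp_comp_clm M₂ v₂)
    simp only [hadd hy₁ hy₂, hadd hy₁ hz]
    exact h₂ _ ⟨v₂, z, hv₂, hz, rfl⟩

end Abstract
-- Compactness of Hilbert–Schmidt operators.
/-- Hilbert–Schmidt operators are compact. -/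
theorem isCompactOperator_of_sum_norm_sq_le {H H' ι : Type*} [NormedAddCommGroup H]
    [InnerProductSpace ℝ H] [NormedAddCommGroup H'] [InnerProductSpace ℝ H'] [CompleteSpace H']
    (e : HilbertBasis ι ℝ H) (A : H →L[ℝ] H') {c : ℝ}
    (hA : ∀ F : Finset ι, ∑ j ∈ F, ‖A (e j)‖ ^ 2 ≤ c) : IsCompactOperator A := by
  classical
  have hs : Summable fun j => ‖A (e j)‖ ^ 2 := summable_of_sum_le (fun j => sq_nonneg _) hA
  set S := ∑' j, ‖A (e j)‖ ^ 2
  let AF : Finset ι → H →L[ℝ] H' := fun F => ∑ j ∈ F, (innerSL ℝ (e j)).smulRight (A (e j))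
  have hAF : ∀ F q, AF F q = A (∑ j ∈ F, inner ℝ (e j) q • e j) := by
    intro F q
    simp [AF]
  -- Cauchy–Schwarz and Bessel on the indices outside `F`: the finite-rank truncations converge to
  -- `A` in operator norm.
  have hbound : ∀ F, ‖AF F - A‖ ≤ Real.sqrt (S - ∑ j ∈ F, ‖A (e j)‖ ^ 2) := by
    intro F
    refine ContinuousLinearMap.opNorm_le_bound _ (Real.sqrt_nonneg _) fun q => ?_
    have hq : HasSum (fun j => inner ℝ (e j) q • e j) q := by
      simpa [e.repr_apply_apply] using e.hasSum_repr q
    have hlim : Tendsto (fun G : Finset ι => ‖AF F q - A (∑ j ∈ G, inner ℝ (e j) q • e j)‖) atTop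
        (𝓝 ‖AF F q - A q‖) :=
      (tendsto_const_nhds.sub ((A.continuous.tendsto q).comp hq)).norm
    refine le_of_tendsto hlim ?_
    filter_upwards [eventually_ge_atTop F] with G hG
    rw [hAF, ← map_sub, ← Finset.sum_sdiff hG, sub_add_cancel_right, map_neg, norm_neg, map_sum]
    refine (norm_sum_le _ _).trans ?_
    have h1 : ∀ j ∈ G \ F, ‖A (inner ℝ (e j) q • e j)‖ = ‖A (e j)‖ * |inner ℝ (e j) q| := by
      intro j _
      rw [map_smul, norm_smul, mul_comm, Real.norm_eq_abs]
    rw [Finset.sum_congr rfl h1]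
    refine (Real.sum_mul_le_sqrt_mul_sqrt _ _ _).trans ?_
    refine mul_le_mul (Real.sqrt_le_sqrt ?_) ?_ (Real.sqrt_nonneg _) (Real.sqrt_nonneg _)
    · have h2 := hs.sum_le_tsum G (fun j _ => sq_nonneg _)
      rw [← Finset.sum_sdiff hG] at h2
      linarith
    · refine Real.sqrt_le_iff.2 ⟨norm_nonneg _, ?_⟩
      simpa using e.orthonormal.sum_inner_products_le q (s := G \ F)
  have htend : Tendsto AF atTop (𝓝 A) := by
    rw [tendsto_iff_norm_sub_tendsto_zero]
    refine squeeze_zero (fun _ => norm_nonneg _) hbound ?_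
    have h1 : Tendsto (fun F : Finset ι => S - ∑ j ∈ F, ‖A (e j)‖ ^ 2) atTop (𝓝 (S - S)) :=
      tendsto_const_nhds.sub hs.hasSum
    simpa using h1.sqrt
  refine isCompactOperator_of_tendsto htend (Eventually.of_forall fun F => ?_)
  refine (compactOperator (RingHom.id ℝ) H H').sum_mem (t := F)
    (f := fun j => ((innerSL ℝ (e j)).smulRight (A (e j)) : H →L[ℝ] H'))
    (fun j _ => ?_)
  exact (isCompactOperator_of_locallyCompactSpace_rng
    (ContinuousLinearMap.toSpanSingleton ℝ (A (e j)))).comp_clm (innerSL ℝ (e j))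

theorem absolutelyContinuousOnInterval_congr {f g : ℝ → ℝ} {a b : ℝ}
    (hf : AbsolutelyContinuousOnInterval f a b) (h : EqOn f g (uIcc a b)) :
    AbsolutelyContinuousOnInterval g a b := by
  rw [absolutelyContinuousOnInterval_iff] at hf ⊢
  intro ε hε
  obtain ⟨δ, hδ, H⟩ := hf ε hε
  refine ⟨δ, hδ, fun E hE hEδ => ?_⟩
  have := H E hE hEδ
  rwa [Finset.sum_congr rfl fun i hi => ?_] at this
  have h1 := hE.1 i hi
  rw [h h1.1, h h1.2]

/-! ### The integral operator inverting `v ↦ -x^{α/2} v_x`. -/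

section Operator

variable {α : ℝ}

/-- The weight `s^{-α/2}`. -/
noncomputable def weight (α s : ℝ) : ℝ := s ^ (-(α / 2))

theorem weight_pos {s : ℝ} (hs : 0 < s) : 0 < weight α s := Real.rpow_pos_of_pos hs _

theorem weight_mul_self {s : ℝ} (hs : 0 < s) : weight α s * weight α s = s ^ (-α) := by
  rw [weight, ← Real.rpow_add hs]; congr 1; ring

theorem weight_mul_rpow {s : ℝ} (hs : 0 < s) : s ^ (α / 2) * weight α s = 1 := by
  rw [weight, ← Real.rpow_add hs]; simp

theorem continuousOn_weight : ContinuousOn (weight α) (Ioi 0) := fun s hs =>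
  (Real.continuousAt_rpow_const s _ (Or.inl (ne_of_gt hs))).continuousWithinAt

theorem one_le_weight (hα : 0 < α) {s : ℝ} (hs : s ∈ Ioo (0 : ℝ) 1) : 1 ≤ weight α s :=
  Real.one_le_rpow_of_pos_of_le_one_of_nonpos hs.1 hs.2.le (by linarith)

theorem integrableOn_rpow {r : ℝ} (hr : -1 < r) : IntegrableOn (fun s : ℝ => s ^ r) (Ioo 0 1) := by
  have := intervalIntegral.intervalIntegrable_rpow' (a := 0) (b := 1) hr
  rwa [intervalIntegrable_iff_integrableOn_Ioo_of_le zero_le_one] at this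

/-- The antiderivative `x ↦ ∫ₓ¹ s^{-α/2} q(s) ds`. -/
noncomputable def tailInt (α : ℝ) (q : ℝ → ℝ) (x : ℝ) : ℝ := ∫ s in x..1, weight α s * q s

theorem memLp_weight_indicator {x : ℝ} (hx : x ∈ Ioo (0 : ℝ) 1) :
    MemLp ((Ioo x 1).indicator (weight α)) 2 muI := by
  rw [memLp_indicator_iff_restrict measurableSet_Ioo, muI, Measure.restrict_restrict_of_subset
    (Ioo_subset_Ioo_left hx.1.le)]
  have hc : ContinuousOn (weight α) (Icc x 1) := continuousOn_weight.mono fun s hs =>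
    hx.1.trans_le hs.1
  obtain ⟨c, hcb⟩ := isCompact_Icc.exists_bound_of_continuousOn hc
  refine MemLp.of_bound ((hc.mono Ioo_subset_Icc_self).aestronglyMeasurable measurableSet_Ioo) c ?_
  exact (ae_restrict_iff' measurableSet_Ioo).2 (Eventually.of_forall fun s hs =>
    hcb s (Ioo_subset_Icc_self hs))

open Classical in
/-- The kernel `s ↦ s^{-α/2} 1_{x < s}` as an element of `L²(0,1)`. -/
noncomputable def tailKernel (α x : ℝ) : L2I :=
  if hx : x ∈ Ioo (0 : ℝ) 1 then (memLp_weight_indicator (α := α) hx).toLp _ else 0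

theorem tailInt_eq_setIntegral {q : ℝ → ℝ} {x : ℝ} (hx : x ∈ Ioo (0 : ℝ) 1) :
    tailInt α q x = ∫ s, (Ioo x 1).indicator (weight α) s * q s ∂muI := by
  rw [tailInt, intervalIntegral.integral_of_le hx.2.le, integral_Ioc_eq_integral_Ioo]
  simp_rw [← indicator_mul_left]
  rw [integral_indicator measurableSet_Ioo, muI, Measure.restrict_restrict_of_subset
    (Ioo_subset_Ioo_left hx.1.le)]

theorem tailInt_eq_inner (q : L2I) {x : ℝ} (hx : x ∈ Ioo (0 : ℝ) 1) :
    tailInt α q x = inner ℝ (tailKernel α x) q := by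
  rw [tailInt_eq_setIntegral hx, L2.inner_def, tailKernel, dif_pos hx]
  refine integral_congr_ae ?_
  filter_upwards [(memLp_weight_indicator (α := α) hx).coeFn_toLp] with s hs
  rw [hs]; simp [mul_comm]

/-- The squared norm is `∫ₓ¹ s^{-α} ds`. Replacing `s^{-α}` by the larger `s^{-α/2-1}` avoids the
logarithm at `α = 1` and gives a bound integrable in `x` for every `α < 2`. -/
theorem norm_tailKernel_sq_le (hα : α ∈ Ioo (0 : ℝ) 2) {x : ℝ} (hx : x ∈ Ioo (0 : ℝ) 1) :
    ‖tailKernel α x‖ ^ 2 ≤ 2 / α * x ^ (-(α / 2)) := by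
  have h1 : ‖tailKernel α x‖ ^ 2 = tailInt α (tailKernel α x) x := by
    rw [tailInt_eq_inner _ hx, real_inner_self_eq_norm_sq]
  have h2 : tailInt α (tailKernel α x) x = ∫ s in x..1, s ^ (-α) := by
    have h3 : ∫ s, (Ioo x 1).indicator (fun s => s ^ (-α)) s ∂muI = ∫ s in x..1, s ^ (-α) := by
      rw [integral_indicator measurableSet_Ioo, Measure.restrict_restrict_of_subset
        (Ioo_subset_Ioo_left hx.1.le), intervalIntegral.integral_of_le hx.2.le,
        integral_Ioc_eq_integral_Ioo]
    rw [tailInt_eq_setIntegral hx, ← h3]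
    refine integral_congr_ae ?_
    rw [tailKernel, dif_pos hx]
    filter_upwards [(memLp_weight_indicator (α := α) hx).coeFn_toLp] with s hs
    rw [hs]
    by_cases hsx : s ∈ Ioo x 1
    · simp only [indicator_of_mem hsx]; exact weight_mul_self (hx.1.trans hsx.1)
    · simp only [indicator_of_notMem hsx, mul_zero]
  rw [h1, h2]
  have h0 : (0 : ℝ) ∉ uIcc x 1 := by
    rw [uIcc_of_le hx.2.le]; exact fun h => absurd h.1 (not_le.2 hx.1)
  have h3 : ∫ s in x..1, s ^ (-α) ≤ ∫ s in x..1, s ^ (-(α / 2) - 1) := by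
    refine intervalIntegral.integral_mono_on hx.2.le
      (intervalIntegral.intervalIntegrable_rpow (Or.inr h0))
      (intervalIntegral.intervalIntegrable_rpow (Or.inr h0)) fun s hs => ?_
    exact Real.rpow_le_rpow_of_exponent_ge (hx.1.trans_le hs.1) hs.2 (by linarith [hα.2])
  refine h3.trans ?_
  rw [integral_rpow (Or.inr ⟨by linarith [hα.1], h0⟩)]
  have h4 : -(α / 2) - 1 + 1 = -(α / 2) := by ring
  rw [h4, Real.one_rpow, div_neg, neg_le, ← mul_neg]
  have hα0 := hα.1
  rw [show (1 - x ^ (-(α / 2))) / (α / 2) = 2 / α * (1 - x ^ (-(α / 2))) by field_simp]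
  have : 0 ≤ 2 / α := by positivity
  nlinarith

theorem tailInt_sq_le (hα : α ∈ Ioo (0 : ℝ) 2) (q : L2I) {x : ℝ} (hx : x ∈ Ioo (0 : ℝ) 1) :
    tailInt α q x ^ 2 ≤ 2 / α * x ^ (-(α / 2)) * ‖q‖ ^ 2 := by
  rw [tailInt_eq_inner q hx]
  have h1 := real_inner_mul_inner_self_le (tailKernel α x) q
  rw [real_inner_self_eq_norm_sq, real_inner_self_eq_norm_sq, ← sq] at h1
  exact h1.trans (mul_le_mul_of_nonneg_right (norm_tailKernel_sq_le hα hx) (sq_nonneg _))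

theorem intervalIntegrable_of_memLp_muI {q : ℝ → ℝ} (hq : MemLp q 2 muI) :
    IntervalIntegrable q volume 0 1 := by
  rw [intervalIntegrable_iff_integrableOn_Ioo_of_le zero_le_one]
  exact hq.integrable one_le_two

theorem intervalIntegrable_weight_mul {q : ℝ → ℝ} (hq : MemLp q 2 muI) {x : ℝ}
    (hx : x ∈ Ioc (0 : ℝ) 1) : IntervalIntegrable (fun s => weight α s * q s) volume x 1 := by
  have hsub : uIcc x 1 ⊆ Ioi 0 := by
    rw [uIcc_of_le hx.2]; exact fun s hs => hx.1.trans_le hs.1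
  refine IntervalIntegrable.continuousOn_mul ?_ (continuousOn_weight.mono hsub)
  refine (intervalIntegrable_of_memLp_muI hq).mono_set ?_
  rw [uIcc_of_le hx.2, uIcc_of_le zero_le_one]
  exact Icc_subset_Icc_left hx.1.le

theorem tailInt_eq_neg (q : ℝ → ℝ) :
    tailInt α q = fun x => -∫ s in 1..x, weight α s * q s := by
  ext x; rw [tailInt, intervalIntegral.integral_symm]

theorem absolutelyContinuousOnInterval_tailInt {q : ℝ → ℝ} (hq : MemLp q 2 muI) {a : ℝ}
    (ha : a ∈ Ioc (0 : ℝ) 1) : AbsolutelyContinuousOnInterval (tailInt α q) a 1 := by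
  rw [tailInt_eq_neg]
  exact ((intervalIntegrable_weight_mul hq ha).absolutelyContinuousOnInterval_intervalIntegral
    right_mem_uIcc).neg

theorem continuousOn_tailInt {q : ℝ → ℝ} (hq : MemLp q 2 muI) :
    ContinuousOn (tailInt α q) (Ioo 0 1) := by
  intro x hx
  have hx2 : x / 2 ∈ Ioc (0 : ℝ) 1 := ⟨by linarith [hx.1], by linarith [hx.1, hx.2]⟩
  have h := (absolutelyContinuousOnInterval_tailInt (α := α) hq hx2).continuousOn
  rw [uIcc_of_le hx2.2] at h
  exact (h.continuousAt (Icc_mem_nhds (by linarith [hx.1]) hx.2)).continuousWithinAt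

/-- The integrand need not be integrable near `0`, so Lebesgue differentiation is applied on the
intervals `[1/(n+1), 1]`, which exhaust `(0,1]`. -/
theorem ae_hasDerivAt_tailInt {q : ℝ → ℝ} (hq : MemLp q 2 muI) :
    ∀ᵐ x ∂muI, HasDerivAt (tailInt α q) (-(weight α x * q x)) x := by
  have h : ∀ n : ℕ, ∀ᵐ x : ℝ, x ∈ Icc (1 / ((n : ℝ) + 1)) 1 →
      HasDerivAt (tailInt α q) (-(weight α x * q x)) x := by
    intro n
    have hn : 1 / ((n : ℝ) + 1) ∈ Ioc (0 : ℝ) 1 :=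
      ⟨by positivity, by rw [div_le_one (by positivity)]; linarith [n.cast_nonneg (α := ℝ)]⟩
    filter_upwards [(intervalIntegrable_weight_mul (α := α) hq hn).ae_hasDerivAt_integral]
      with x hx hxm
    rw [uIcc_of_le hn.2] at hx
    rw [tailInt_eq_neg]
    exact (hx hxm 1 (right_mem_Icc.2 hn.2)).neg
  rw [muI, ae_restrict_iff' measurableSet_Ioo]
  filter_upwards [ae_all_iff.2 h] with x hx hx1
  obtain ⟨n, hn⟩ := exists_nat_one_div_lt hx1.1
  exact hx n ⟨hn.le, hx1.2.le⟩

theorem memLp_tailInt (hα : α ∈ Ioo (0 : ℝ) 2) (q : L2I) : MemLp (tailInt α q) 2 muI := by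
  have hm : AEStronglyMeasurable (tailInt α q) muI :=
    (continuousOn_tailInt (Lp.memLp q)).aestronglyMeasurable measurableSet_Ioo
  rw [memLp_two_iff_integrable_sq hm]
  have hi : Integrable (fun x : ℝ => 2 / α * x ^ (-(α / 2)) * ‖q‖ ^ 2) muI :=
    ((integrableOn_rpow (by linarith [hα.2])).const_mul _).mul_const _
  refine hi.mono' (hm.pow 2) ((ae_restrict_iff' measurableSet_Ioo).2
    (Eventually.of_forall fun x hx => ?_))
  rw [Real.norm_of_nonneg (sq_nonneg _)]
  exact tailInt_sq_le hα q hx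

theorem tailInt_congr {q q' : ℝ → ℝ} (h : q =ᵐ[muI] q') {x : ℝ} (hx : x ∈ Ioo (0 : ℝ) 1) :
    tailInt α q x = tailInt α q' x := by
  rw [tailInt_eq_setIntegral hx, tailInt_eq_setIntegral hx]
  refine integral_congr_ae ?_
  filter_upwards [h] with s hs
  rw [hs]

theorem norm_toLp_tailInt_le (hα : α ∈ Ioo (0 : ℝ) 2) (q : L2I) :
    ‖(memLp_tailInt hα q).toLp _‖ ≤
      Real.sqrt (∫ x, 2 / α * x ^ (-(α / 2)) ∂muI) * ‖q‖ := by
  rw [← Real.sqrt_sq (norm_nonneg q), ← Real.sqrt_mul' _ (sq_nonneg _)]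
  refine Real.le_sqrt_of_sq_le ?_
  rw [← real_inner_self_eq_norm_sq, L2.inner_def, ← integral_mul_const]
  have hi : Integrable (fun x : ℝ => 2 / α * x ^ (-(α / 2)) * ‖q‖ ^ 2) muI :=
    ((integrableOn_rpow (by linarith [hα.2])).const_mul _).mul_const _
  refine integral_mono_ae (L2.integrable_inner _ _) hi ?_
  filter_upwards [(memLp_tailInt hα q).coeFn_toLp, ae_restrict_mem measurableSet_Ioo] with x h1 hx
  rw [h1, real_inner_self_eq_norm_sq, Real.norm_eq_abs, sq_abs]
  exact tailInt_sq_le hα q hx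

/-- The operator `q ↦ ∫ₓ¹ s^{-α/2} q(s) ds` on `L²(0,1)`. -/
noncomputable def tailOp (hα : α ∈ Ioo (0 : ℝ) 2) : L2I →L[ℝ] L2I :=
  LinearMap.mkContinuous
    { toFun := fun q => (memLp_tailInt hα q).toLp _
      map_add' := fun q r => by
        rw [← MemLp.toLp_add, MemLp.toLp_eq_toLp_iff]
        filter_upwards [ae_restrict_mem measurableSet_Ioo] with x hx
        simp only [Pi.add_apply, tailInt_eq_inner _ hx, inner_add_right]
      map_smul' := fun c q => by
        rw [← MemLp.toLp_const_smul, MemLp.toLp_eq_toLp_iff]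
        filter_upwards [ae_restrict_mem measurableSet_Ioo] with x hx
        simp only [RingHom.id_apply, Pi.smul_apply, tailInt_eq_inner _ hx, inner_smul_right,
          smul_eq_mul] }
    _ (norm_toLp_tailInt_le hα)

theorem tailOp_coeFn (hα : α ∈ Ioo (0 : ℝ) 2) (q : L2I) : tailOp hα q =ᵐ[muI] tailInt α q :=
  (memLp_tailInt hα q).coeFn_toLp

/-- At each `x`, Bessel's inequality bounds the squares of the values of the images of a Hilbert
basis by the squared norm of the kernel, which is integrable in `x`. -/
theorem isCompactOperator_tailOp (hα : α ∈ Ioo (0 : ℝ) 2) : IsCompactOperator (tailOp hα) := by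
  obtain ⟨w, e, -⟩ := exists_hilbertBasis ℝ L2I
  refine isCompactOperator_of_sum_norm_sq_le e (tailOp hα)
    (c := ∫ x, 2 / α * x ^ (-(α / 2)) ∂muI) fun F => ?_
  have h1 : ∀ q : L2I, ‖tailOp hα q‖ ^ 2 = ∫ x, tailInt α q x ^ 2 ∂muI := by
    intro q
    rw [← real_inner_self_eq_norm_sq, L2.inner_def]
    refine integral_congr_ae ?_
    filter_upwards [tailOp_coeFn hα q] with x hx
    rw [hx, real_inner_self_eq_norm_sq, Real.norm_eq_abs, sq_abs]
  simp_rw [h1]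
  rw [← integral_finsetSum _ fun j _ => (memLp_tailInt hα (e j)).integrable_sq]
  refine integral_mono_ae (integrable_finsetSum _ fun j _ =>
    (memLp_tailInt hα (e j)).integrable_sq)
    ((integrableOn_rpow (by linarith [hα.2])).const_mul _) ?_
  filter_upwards [ae_restrict_mem measurableSet_Ioo] with x hx
  refine le_trans ?_ (norm_tailKernel_sq_le hα hx)
  refine le_trans (le_of_eq ?_) (e.orthonormal.sum_inner_products_le (tailKernel α x) (s := F))
  refine Finset.sum_congr rfl fun j _ => ?_
  rw [tailInt_eq_inner _ hx, real_inner_comm, Real.norm_eq_abs, sq_abs]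

theorem deriv_tailInt_ae {q : ℝ → ℝ} (hq : MemLp q 2 muI) :
    (fun x => x ^ (α / 2) * deriv (tailInt α q) x) =ᵐ[muI] fun x => -q x := by
  filter_upwards [ae_hasDerivAt_tailInt (α := α) hq, ae_restrict_mem measurableSet_Ioo] with x hx hx0
  rw [hx.deriv, mul_neg, ← mul_assoc, weight_mul_rpow hx0.1, one_mul]

theorem memH1_tailInt (hα : α ∈ Ioo (0 : ℝ) 2) {q : ℝ → ℝ} (hq : MemLp q 2 muI) :
    MemH1 α (tailInt α q) where
  memL2 := by
    refine (memLp_congr_ae ?_).1 (memLp_tailInt hα (hq.toLp q))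
    filter_upwards [ae_restrict_mem measurableSet_Ioo] with x hx
    exact tailInt_congr hq.coeFn_toLp hx
  absCont a ha := absolutelyContinuousOnInterval_tailInt hq ⟨ha.1, ha.2.le⟩
  weightedDeriv := (memLp_congr_ae (deriv_tailInt_ae hq)).2 hq.neg
  right_zero := by simp [tailInt]

theorem lintegral_energy_tailInt (q : L2I) :
    ∫⁻ x in Ioo (0 : ℝ) 1, ENNReal.ofReal ((x ^ (α / 2) * deriv (tailInt α q) x) ^ 2) =
      ENNReal.ofReal (‖q‖ ^ 2) := by
  rw [← real_inner_self_eq_norm_sq, L2.inner_def,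
    ofReal_integral_eq_lintegral_ofReal (L2.integrable_inner _ _)
      (Eventually.of_forall fun x => real_inner_self_nonneg)]
  refine lintegral_congr_ae ?_
  filter_upwards [deriv_tailInt_ae (α := α) (Lp.memLp q)] with x hx
  rw [hx, real_inner_self_eq_norm_sq, Real.norm_eq_abs, sq_abs, neg_sq]

end Operator
-- The adjoint integral operator.
section Adjoint

variable {α : ℝ}

/-- The primitive `x ↦ ∫₀ˣ φ`. -/
noncomputable def headInt (φ : ℝ → ℝ) (x : ℝ) : ℝ := ∫ s in 0..x, φ s

theorem headInt_eq_setIntegral {φ : ℝ → ℝ} {x : ℝ} (hx : x ∈ Ioo (0 : ℝ) 1) :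
    headInt φ x = ∫ s, (Ioo 0 x).indicator (fun _ => (1 : ℝ)) s * φ s ∂muI := by
  rw [headInt, intervalIntegral.integral_of_le hx.1.le, integral_Ioc_eq_integral_Ioo]
  simp_rw [← indicator_mul_left]
  rw [integral_indicator measurableSet_Ioo, muI, Measure.restrict_restrict_of_subset
    (Ioo_subset_Ioo_right hx.2.le)]
  simp

theorem abs_headInt_le {φ : ℝ → ℝ} (hφ : MemLp φ 2 muI) {x : ℝ} (hx : x ∈ Ioo (0 : ℝ) 1) :
    |headInt φ x| ≤ x ^ (1 / 2 : ℝ) * ‖hφ.toLp φ‖ := by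
  have h1 : headInt φ x = inner ℝ (indicatorConstLp 2 (μ := muI) (measurableSet_Ioo : MeasurableSet (Ioo 0 x))
      (measure_ne_top _ _) (1 : ℝ)) (hφ.toLp φ) := by
    rw [headInt_eq_setIntegral hx, L2.inner_def]
    refine integral_congr_ae ?_
    filter_upwards [indicatorConstLp_coeFn (p := 2) (μ := muI) (hs := (measurableSet_Ioo : MeasurableSet (Ioo 0 x)))
      (hμs := measure_ne_top _ _) (c := (1 : ℝ)), hφ.coeFn_toLp] with s h1 h2
    rw [h1, h2]; simp [mul_comm]
  rw [h1]
  refine (abs_real_inner_le_norm _ _).trans (mul_le_mul_of_nonneg_right ?_ (norm_nonneg _))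
  rw [norm_indicatorConstLp (by norm_num) (by norm_num), measureReal_def, muI,
    Measure.restrict_apply measurableSet_Ioo,
    inter_eq_left.2 (Ioo_subset_Ioo_right hx.2.le), Real.volume_Ioo]
  simp [hx.1.le]

theorem continuousOn_headInt {φ : ℝ → ℝ} (hφ : MemLp φ 2 muI) :
    ContinuousOn (headInt φ) (Icc 0 1) := by
  have := ((intervalIntegrable_of_memLp_muI hφ).absolutelyContinuousOnInterval_intervalIntegral
    left_mem_uIcc).continuousOn
  rwa [uIcc_of_le zero_le_one] at this

theorem weight_mul_rpow_half_sq {s : ℝ} (hs : 0 < s) :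
    (weight α s * s ^ (1 / 2 : ℝ)) ^ 2 = s ^ (1 - α) := by
  rw [weight, ← Real.rpow_add hs, ← Real.rpow_natCast, ← Real.rpow_mul hs.le]
  congr 1; push_cast; ring

theorem aestronglyMeasurable_weight : AEStronglyMeasurable (weight α) muI :=
  (continuousOn_weight.mono fun _ hs => hs.1).aestronglyMeasurable measurableSet_Ioo

theorem memLp_weight_mul_rpow_half (hα : α ∈ Ioo (0 : ℝ) 2) :
    MemLp (fun s => weight α s * s ^ (1 / 2 : ℝ)) 2 muI := by
  have hm : AEStronglyMeasurable (fun s => weight α s * s ^ (1 / 2 : ℝ)) muI :=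
    aestronglyMeasurable_weight.mul (by fun_prop)
  rw [memLp_two_iff_integrable_sq hm]
  refine (integrableOn_rpow (r := 1 - α) (by linarith [hα.2])).congr ?_
  filter_upwards [ae_restrict_mem measurableSet_Ioo] with s hs
  exact (weight_mul_rpow_half_sq hs.1).symm

/-- By Cauchy–Schwarz the primitive is `O(s^{1/2})`, so the square of the product is `O(s^{1-α})`,
integrable since `α < 2`. -/
theorem memLp_weight_mul_headInt (hα : α ∈ Ioo (0 : ℝ) 2) {φ : ℝ → ℝ} (hφ : MemLp φ 2 muI) :
    MemLp (fun s => weight α s * headInt φ s) 2 muI := by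
  refine ((memLp_weight_mul_rpow_half hα).mul_const ‖hφ.toLp φ‖).mono
    (aestronglyMeasurable_weight.mul
      (((continuousOn_headInt hφ).mono Ioo_subset_Icc_self).aestronglyMeasurable
        measurableSet_Ioo)) ?_
  filter_upwards [ae_restrict_mem measurableSet_Ioo] with s hs
  have h1 := (weight_pos (α := α) hs.1).le
  have h2 : 0 ≤ s ^ (1 / 2 : ℝ) := Real.rpow_nonneg hs.1.le _
  rw [norm_mul, norm_mul, norm_mul, Real.norm_of_nonneg h1, Real.norm_of_nonneg h2, norm_norm, mul_assoc]
  exact mul_le_mul_of_nonneg_left (abs_headInt_le hφ hs) h1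

/-- Fubini on the triangle `x < s`; this identifies the adjoint of `tailOp`. -/
theorem integral_mul_tailInt (hα : α ∈ Ioo (0 : ℝ) 2) (φ q : L2I) :
    ∫ x, φ x * tailInt α q x ∂muI = ∫ s, weight α s * headInt φ s * q s ∂muI := by
  let S : Set (ℝ × ℝ) := {p | p.1 < p.2}
  have hS : MeasurableSet S := measurableSet_lt measurable_fst measurable_snd
  let F : ℝ × ℝ → ℝ := S.indicator fun p => φ p.1 * (weight α p.2 * q p.2)
  have hwq : AEStronglyMeasurable (fun s => weight α s * q s) muI :=
    aestronglyMeasurable_weight.mul (Lp.aestronglyMeasurable q)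
  have hFm : AEStronglyMeasurable F (muI.prod muI) :=
    ((Lp.aestronglyMeasurable φ).comp_fst.mul hwq.comp_snd).indicator hS
  have hφi : Integrable φ muI := (Lp.memLp φ).integrable one_le_two
  have hφa : MemLp (fun x => |φ x|) 2 muI := (Lp.memLp φ).abs
  -- The triangle is cut out by `x < s` alone, so a correction on `x ≤ 0` appears; it is null for
  -- `muI`.
  have hsec : ∀ s ∈ Ioo (0 : ℝ) 1, (fun x => F (x, s)) =
      fun x => (weight α s * q s) * ((Ioo 0 s).indicator (fun _ => (1 : ℝ)) x * φ x) +
        (Iic 0).indicator (fun x => F (x, s)) x := by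
    intro s hs
    ext x
    simp only [F, S, indicator, mem_ofPred_eq, mem_Ioo, mem_Iic]
    split_ifs <;> first | (exfalso; grind) | ring
  have hzero : ∀ s, (fun x => (Iic 0).indicator (fun x => F (x, s)) x) =ᵐ[muI] 0 := by
    intro s
    filter_upwards [ae_restrict_mem measurableSet_Ioo] with x hx
    exact indicator_of_notMem (not_le.2 hx.1) _
  have hsec' : ∀ s ∈ Ioo (0 : ℝ) 1, (fun x => F (x, s)) =ᵐ[muI]
      fun x => (weight α s * q s) * ((Ioo 0 s).indicator (fun _ => (1 : ℝ)) x * φ x) := by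
    intro s hs
    rw [hsec s hs]
    filter_upwards [hzero s] with x hx
    rw [hx]; simp
  have hindφ : ∀ s, Integrable (fun x => (Ioo 0 s).indicator (fun _ => (1 : ℝ)) x * φ x) muI := by
    intro s
    have : (fun x => (Ioo 0 s).indicator (fun _ => (1 : ℝ)) x * φ x) = (Ioo 0 s).indicator φ := by
      ext x; simp [indicator]
    rw [this]
    exact hφi.indicator measurableSet_Ioo
  have hFi : Integrable F (muI.prod muI) := by
    rw [integrable_prod_iff' hFm]
    constructor
    · filter_upwards [ae_restrict_mem measurableSet_Ioo] with s hs
      exact ((hindφ s).const_mul _).congr (hsec' s hs).symm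
    · have hdom : Integrable (fun s => ‖hφa.toLp _‖ * (weight α s * s ^ (1 / 2 : ℝ) * |q s|)) muI :=
        ((memLp_weight_mul_rpow_half hα).integrable_mul (Lp.memLp q).abs).const_mul _
      refine hdom.mono' hFm.norm.prod_swap.integral_prod_right' ?_
      filter_upwards [ae_restrict_mem measurableSet_Ioo] with s hs
      have h1 : ∫ x, ‖F (x, s)‖ ∂muI = |weight α s * q s| * headInt (fun x => |φ x|) s := by
        rw [headInt_eq_setIntegral hs, ← integral_const_mul]
        refine integral_congr_ae ?_
        filter_upwards [hsec' s hs] with x hx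
        rw [hx]
        by_cases hxs : x ∈ Ioo 0 s <;> simp [hxs, abs_mul]
      have h2 := abs_headInt_le hφa hs
      have h3 := (weight_pos (α := α) hs.1).le
      rw [h1, norm_mul, Real.norm_eq_abs, abs_abs, Real.norm_eq_abs, abs_mul, abs_of_nonneg h3]
      calc _ ≤ weight α s * |q s| * (s ^ (1 / 2 : ℝ) * ‖hφa.toLp _‖) := by gcongr
        _ = _ := by ring
  have hswap := integral_integral_swap (f := fun x s => F (x, s)) hFi
  have hL : ∫ x, φ x * tailInt α q x ∂muI = ∫ x, ∫ s, F (x, s) ∂muI ∂muI := by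
    refine integral_congr_ae ?_
    filter_upwards [ae_restrict_mem measurableSet_Ioo] with x hx
    rw [tailInt_eq_setIntegral hx, ← integral_const_mul]
    refine integral_congr_ae ?_
    filter_upwards [ae_restrict_mem measurableSet_Ioo] with s hs
    simp only [F, S, indicator, mem_ofPred_eq, mem_Ioo]
    split_ifs <;> first | (exfalso; grind) | ring
  rw [hL, hswap]
  refine integral_congr_ae ?_
  filter_upwards [ae_restrict_mem measurableSet_Ioo] with s hs
  rw [integral_congr_ae (hsec' s hs), integral_const_mul, ← headInt_eq_setIntegral hs]
  ring

theorem adjoint_tailOp (hα : α ∈ Ioo (0 : ℝ) 2) (φ : L2I) :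
    ContinuousLinearMap.adjoint (tailOp hα) φ =
      (memLp_weight_mul_headInt hα (Lp.memLp φ)).toLp _ := by
  refine ext_inner_right ℝ fun q => ?_
  rw [ContinuousLinearMap.adjoint_inner_left, L2.inner_def, L2.inner_def]
  have h1 : ∫ x, inner ℝ (φ x) (tailOp hα q x) ∂muI = ∫ x, φ x * tailInt α q x ∂muI := by
    refine integral_congr_ae ?_
    filter_upwards [tailOp_coeFn hα q] with x hx
    rw [hx]; simp [mul_comm]
  rw [h1, integral_mul_tailInt hα]
  refine integral_congr_ae ?_
  filter_upwards [(memLp_weight_mul_headInt hα (Lp.memLp φ)).coeFn_toLp] with s hs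
  rw [hs]; simp [mul_comm]

end Adjoint
-- The boundary condition at `0` and the identity `-A = (C C†)⁻¹`.
section Domain

variable {α : ℝ}

theorem memLp_weight (h1 : α < 1) : MemLp (weight α) 2 muI := by
  rw [memLp_two_iff_integrable_sq aestronglyMeasurable_weight]
  refine (integrableOn_rpow (r := -α) (by linarith)).congr ?_
  filter_upwards [ae_restrict_mem measurableSet_Ioo] with s hs
  rw [sq, weight_mul_self hs.1]

open Classical in
/-- The vector to which `v ↦ -x^{α/2} v_x` has to be orthogonal for `v(0) = 0` if `α < 1`, and
zero otherwise. -/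
noncomputable def traceVec (α : ℝ) : L2I :=
  if h : α < 1 then (memLp_weight h).toLp _ else 0

/-- The orthogonal projection encoding the boundary condition at `0`. -/
noncomputable def traceProj (α : ℝ) : L2I →L[ℝ] L2I :=
  (ℝ ∙ traceVec α)ᗮ.starProjection

/-- The factor `C` of the inverse `C C†` of `-A`. -/
noncomputable def factorOp (hα : α ∈ Ioo (0 : ℝ) 2) : L2I →L[ℝ] L2I :=
  tailOp hα ∘L traceProj α

theorem isCompactOperator_factorOp (hα : α ∈ Ioo (0 : ℝ) 2) : IsCompactOperator (factorOp hα) :=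
  (isCompactOperator_tailOp hα).comp_clm (traceProj α)

theorem adjoint_factorOp (hα : α ∈ Ioo (0 : ℝ) 2) (φ : L2I) :
    ContinuousLinearMap.adjoint (factorOp hα) φ =
      traceProj α (ContinuousLinearMap.adjoint (tailOp hα) φ) := by
  refine ext_inner_right ℝ fun q => ?_
  rw [ContinuousLinearMap.adjoint_inner_left, factorOp, ContinuousLinearMap.comp_apply,
    ← ContinuousLinearMap.adjoint_inner_left, traceProj, Submodule.inner_starProjection_left_eq_right]

theorem inner_traceVec_traceProj (q : L2I) :
    inner ℝ (traceVec α) (traceProj α q) = 0 :=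
  Submodule.mem_orthogonal_singleton_iff_inner_right.1 (Submodule.starProjection_apply_mem _ q)

/-- For `α < 1` the weight is in `L²`, so the tail integral is continuous up to `0`, with value
`⟨weight, q⟩` there. -/
theorem tendsto_tailInt_zero (h1 : α < 1) {q : L2I}
    (hq : inner ℝ (traceVec α) q = 0) : Tendsto (tailInt α q) (𝓝[>] 0) (𝓝 0) := by
  have hi : Integrable (fun s => weight α s * q s) muI :=
    (memLp_weight h1).integrable_mul (Lp.memLp q)
  have hi' : IntervalIntegrable (fun s => weight α s * q s) volume 0 1 := by
    rwa [intervalIntegrable_iff_integrableOn_Ioo_of_le zero_le_one]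
  have hcont : ContinuousOn (tailInt α q) (Icc 0 1) := by
    rw [tailInt_eq_neg, ← uIcc_of_le zero_le_one]
    exact (hi'.absolutelyContinuousOnInterval_intervalIntegral right_mem_uIcc).neg.continuousOn
  have h0 : tailInt α q 0 = 0 := by
    refine Eq.trans ?_ hq
    rw [tailInt, intervalIntegral.integral_of_le zero_le_one, integral_Ioc_eq_integral_Ioo,
      L2.inner_def, traceVec, dif_pos h1]
    refine integral_congr_ae ?_
    filter_upwards [(memLp_weight h1).coeFn_toLp] with s hs
    rw [hs]; simp [mul_comm]
  have h := (hcont 0 (left_mem_Icc.2 zero_le_one)).tendsto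
  rw [h0] at h
  refine h.mono_left ?_
  rw [← nhdsWithin_Ioo_eq_nhdsGT zero_lt_one]
  exact nhdsWithin_mono _ Ioo_subset_Icc_self

/-- Elements of the range of `C` are in `H¹_α`, with the boundary conditions. -/
theorem exists_memH1_of_factorOp (hα : α ∈ Ioo (0 : ℝ) 2) (q : L2I) :
    ∃ Y : ℝ → ℝ, factorOp hα q =ᵐ[muI] Y ∧ MemH1 α Y ∧ (α < 1 → Tendsto Y (𝓝[>] 0) (𝓝 0)) ∧
      ∫⁻ x in Ioo (0 : ℝ) 1, ENNReal.ofReal ((x ^ (α / 2) * deriv Y x) ^ 2) ≤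
        ENNReal.ofReal (‖q‖ ^ 2) := by
  refine ⟨tailInt α (traceProj α q), tailOp_coeFn hα _, memH1_tailInt hα (Lp.memLp _),
    fun h1 => tendsto_tailInt_zero h1 (inner_traceVec_traceProj q), ?_⟩
  rw [lintegral_energy_tailInt]
  refine ENNReal.ofReal_le_ofReal ?_
  have : ‖traceProj α q‖ ≤ ‖q‖ := Submodule.norm_starProjection_apply_le _ q
  gcongr

/-- The projection subtracts a multiple `d` of the weight, and `d` becomes the integration constant
of the flux. For `α < 1` it is fixed by the Dirichlet condition; for `1 ≤ α` nothing is projected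
out and the flux vanishes at `0`. -/
theorem exists_adjoint_factorOp_eq (hα : α ∈ Ioo (0 : ℝ) 2) (φ : L2I) :
    ∃ d : ℝ, (1 ≤ α → d = 0) ∧ ContinuousLinearMap.adjoint (factorOp hα) φ =ᵐ[muI]
      fun s => weight α s * (headInt φ s - d) := by
  set p := ContinuousLinearMap.adjoint (tailOp hα) φ with hp
  have hmem : p - traceProj α p ∈ (ℝ ∙ traceVec α) := by
    have := Submodule.sub_starProjection_mem_orthogonal (K := (ℝ ∙ traceVec α)ᗮ) p
    rwa [Submodule.orthogonal_orthogonal] at this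
  obtain ⟨c, hc⟩ := Submodule.mem_span_singleton.1 hmem
  have hcoe := (memLp_weight_mul_headInt hα (Lp.memLp φ)).coeFn_toLp
  rw [← adjoint_tailOp hα φ, ← hp] at hcoe
  have hproj : traceProj α p = p - c • traceVec α := by rw [hc]; abel
  rw [adjoint_factorOp, ← hp, hproj]
  by_cases h1 : α < 1
  · refine ⟨c, fun h => absurd h1 (not_lt.2 h), ?_⟩
    rw [traceVec, dif_pos h1]
    filter_upwards [hcoe, Lp.coeFn_sub p (c • (memLp_weight h1).toLp _),
      Lp.coeFn_smul c ((memLp_weight h1).toLp _), (memLp_weight h1).coeFn_toLp]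
      with s h2 h3 h4 h5
    rw [h3, Pi.sub_apply, h4, Pi.smul_apply, h2, h5, smul_eq_mul]
    ring
  · refine ⟨0, fun _ => rfl, ?_⟩
    rw [traceVec, dif_neg h1, smul_zero, sub_zero]
    filter_upwards [hcoe] with s hs
    rw [hs, sub_zero]

theorem ae_hasDerivAt_headInt {φ : ℝ → ℝ} (hφ : MemLp φ 2 muI) :
    ∀ᵐ x ∂muI, HasDerivAt (headInt φ) (φ x) x := by
  rw [muI, ae_restrict_iff' measurableSet_Ioo]
  filter_upwards [(intervalIntegrable_of_memLp_muI hφ).ae_hasDerivAt_integral] with x hx hxm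
  rw [uIcc_of_le zero_le_one] at hx
  exact hx (Ioo_subset_Icc_self hxm) 0 (left_mem_Icc.2 zero_le_one)

theorem tendsto_headInt_zero {φ : ℝ → ℝ} (hφ : MemLp φ 2 muI) :
    Tendsto (headInt φ) (𝓝[>] 0) (𝓝 0) := by
  have h := (continuousOn_headInt hφ 0 (left_mem_Icc.2 zero_le_one)).tendsto
  rw [show headInt φ 0 = 0 by simp [headInt]] at h
  refine h.mono_left ?_
  rw [← nhdsWithin_Ioo_eq_nhdsGT zero_lt_one]
  exact nhdsWithin_mono _ Ioo_subset_Icc_self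

/-- If `C†φ = s^{-α/2}(Φ - d)` with `Φ = ∫₀ φ`, then `C C†φ` is the function with flux `d - Φ`
vanishing at `1`. -/
theorem factorOp_adjoint_ae (hα : α ∈ Ioo (0 : ℝ) 2) {φ : L2I} {d : ℝ}
    (hd : ContinuousLinearMap.adjoint (factorOp hα) φ =ᵐ[muI]
      fun s => weight α s * (headInt φ s - d)) :
    factorOp hα (ContinuousLinearMap.adjoint (factorOp hα) φ) =ᵐ[muI]
      tailInt α fun s => weight α s * (headInt φ s - d) := by
  have h1 : factorOp hα (ContinuousLinearMap.adjoint (factorOp hα) φ) =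
      tailOp hα (ContinuousLinearMap.adjoint (factorOp hα) φ) := by
    rw [adjoint_factorOp, factorOp, ContinuousLinearMap.comp_apply]
    congr 1
    -- The range of `C†` is already inside the range of the projection, which therefore acts
    -- trivially on it.
    exact Submodule.starProjection_eq_self_iff.2 (Submodule.starProjection_apply_mem _ _)
  rw [h1]
  filter_upwards [tailOp_coeFn hα (ContinuousLinearMap.adjoint (factorOp hα) φ),
    ae_restrict_mem measurableSet_Ioo] with x hx hx0
  rw [hx, tailInt_congr hd hx0]

theorem memLp_of_adjoint_ae (hα : α ∈ Ioo (0 : ℝ) 2) {φ : L2I} {d : ℝ}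
    (hd : ContinuousLinearMap.adjoint (factorOp hα) φ =ᵐ[muI]
      fun s => weight α s * (headInt φ s - d)) :
    MemLp (fun s => weight α s * (headInt φ s - d)) 2 muI :=
  (memLp_congr_ae hd).1 (Lp.memLp _)

/-- A derivative at every point is needed: `flux` is defined through `deriv` and is differentiated
once more in `opA`. -/
theorem hasDerivAt_tailInt {q : ℝ → ℝ} (hq : MemLp q 2 muI) (hc : ContinuousOn q (Ioo 0 1))
    {x : ℝ} (hx : x ∈ Ioo (0 : ℝ) 1) : HasDerivAt (tailInt α q) (-(weight α x * q x)) x := by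
  have hcw : ContinuousOn (fun s => weight α s * q s) (Ioo 0 1) :=
    (continuousOn_weight.mono fun _ hs => hs.1).mul hc
  exact intervalIntegral.integral_hasDerivAt_left
    (intervalIntegrable_weight_mul hq ⟨hx.1, hx.2.le⟩)
    (hcw.stronglyMeasurableAtFilter isOpen_Ioo x hx) (hcw.continuousAt (Ioo_mem_nhds hx.1 hx.2))

theorem continuousOn_weight_mul_headInt_sub {φ : L2I} {d : ℝ} :
    ContinuousOn (fun s => weight α s * (headInt φ s - d)) (Ioo 0 1) :=
  (continuousOn_weight.mono fun _ hs => hs.1).mul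
    (((continuousOn_headInt (Lp.memLp φ)).mono Ioo_subset_Icc_self).sub continuousOn_const)

theorem flux_tailInt (hα : α ∈ Ioo (0 : ℝ) 2) {φ : L2I} {d : ℝ}
    (hd : ContinuousLinearMap.adjoint (factorOp hα) φ =ᵐ[muI]
      fun s => weight α s * (headInt φ s - d)) {x : ℝ} (hx : x ∈ Ioo (0 : ℝ) 1) :
    flux α (tailInt α fun s => weight α s * (headInt φ s - d)) x = d - headInt φ x := by
  rw [flux, (hasDerivAt_tailInt (memLp_of_adjoint_ae hα hd)
    continuousOn_weight_mul_headInt_sub hx).deriv, ← mul_assoc, weight_mul_self hx.1, mul_neg,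
    ← mul_assoc, ← Real.rpow_add hx.1, add_neg_cancel, Real.rpow_zero]
  ring

theorem opA_congr {v : ℝ → ℝ} {F : ℝ → ℝ} (h : EqOn (flux α v) F (Ioo 0 1)) {x : ℝ}
    (hx : x ∈ Ioo (0 : ℝ) 1) : opA α v x = deriv F x :=
  (h.eventuallyEq_of_mem (Ioo_mem_nhds hx.1 hx.2)).deriv_eq

/-- `C C†` maps into the domain of `A`, and `A C C† = -1`. -/
theorem exists_memDomA_of_factorOp (hα : α ∈ Ioo (0 : ℝ) 2) (φ : L2I) :
    ∃ v, MemDomA α v ∧ factorOp hα (ContinuousLinearMap.adjoint (factorOp hα) φ) =ᵐ[muI] v ∧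
      opA α v =ᵐ[muI] fun x => -φ x := by
  obtain ⟨d, hd0, hd⟩ := exists_adjoint_factorOp_eq hα φ
  set v := tailInt α fun s => weight α s * (headInt φ s - d)
  have hmem := memLp_of_adjoint_ae hα hd
  have hflux : EqOn (flux α v) (fun x => d - headInt φ x) (Ioo 0 1) := fun x hx =>
    flux_tailInt hα hd hx
  have hopA : opA α v =ᵐ[muI] fun x => -φ x := by
    filter_upwards [ae_hasDerivAt_headInt (Lp.memLp φ), ae_restrict_mem measurableSet_Ioo]
      with x hx hx0
    rw [opA_congr hflux hx0, (hx.const_sub d).deriv]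
  refine ⟨v, ⟨memH1_tailInt hα hmem, fun a b' ha hab hb => ?_, ?_, ?_, ?_⟩,
    factorOp_adjoint_ae hα hd, hopA⟩
  · have hsub : uIcc a b' ⊆ Ioo 0 1 := by
      rw [uIcc_of_le hab]; exact fun x hx => ⟨ha.trans_le hx.1, hx.2.trans_lt hb⟩
    have h1 := ((intervalIntegrable_of_memLp_muI
      (Lp.memLp φ)).absolutelyContinuousOnInterval_intervalIntegral (c := 0) left_mem_uIcc).mono
      (hsub.trans (by rw [uIcc_of_le zero_le_one]; exact Ioo_subset_Icc_self))
    have h2 : AbsolutelyContinuousOnInterval (fun _ : ℝ => d) a b' :=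
      ContDiffOn.absolutelyContinuousOnInterval (by fun_prop)
    exact absolutelyContinuousOnInterval_congr (h2.sub h1) fun x hx => (hflux (hsub hx)).symm
  · exact (memLp_congr_ae hopA).2 (Lp.memLp φ).neg
  · intro h1
    have h := tendsto_tailInt_zero h1 (q := ContinuousLinearMap.adjoint (factorOp hα) φ)
      (by rw [adjoint_factorOp]; exact inner_traceVec_traceProj _)
    refine h.congr' ?_
    filter_upwards [Ioo_mem_nhdsGT zero_lt_one] with x hx
    exact tailInt_congr hd hx
  · intro h1
    have h : Tendsto (fun x => d - headInt φ x) (𝓝[>] 0) (𝓝 (d - 0)) :=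
      tendsto_const_nhds.sub (tendsto_headInt_zero (Lp.memLp φ))
    rw [hd0 h1, sub_zero] at h
    refine h.congr' ?_
    filter_upwards [Ioo_mem_nhdsGT zero_lt_one] with x hx
    rw [hflux hx, hd0 h1]

/-- On the domain of `A`, `v = -C C† A v`. -/
theorem factorOp_adjoint_eq_of_memDomA (hα : α ∈ Ioo (0 : ℝ) 2) {v : ℝ → ℝ} (hv : MemDomA α v)
    {φ : L2I} (hφ : opA α v =ᵐ[muI] fun x => -φ x) :
    factorOp hα (ContinuousLinearMap.adjoint (factorOp hα) φ) =ᵐ[muI] v := by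
  obtain ⟨d, hd0, hd⟩ := exists_adjoint_factorOp_eq hα φ
  have hmem := memLp_of_adjoint_ae hα hd
  have hφi := intervalIntegrable_of_memLp_muI (Lp.memLp φ)
  have hmid : (1 / 2 : ℝ) ∈ Ioo (0 : ℝ) 1 := by norm_num
  set d₂ := flux α v (1 / 2) + headInt φ (1 / 2)
  have hsubI : ∀ {x y : ℝ}, x ∈ Ioo (0 : ℝ) 1 → y ∈ Ioo (0 : ℝ) 1 → uIcc x y ⊆ Ioo 0 1 :=
    fun hx hy => ordConnected_Ioo.uIcc_subset hx hy
  -- Integrate `A v = -φ` from the interior point `1/2`, since absolute continuity of the flux is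
  -- only assumed inside `(0,1)`.
  have hfluxv : ∀ x ∈ Ioo (0 : ℝ) 1, flux α v x = d₂ - headInt φ x := by
    intro x hx
    have hac : AbsolutelyContinuousOnInterval (flux α v) (1 / 2) x := by
      rcases le_total (1 / 2) x with h | h
      · exact hv.fluxAbsCont _ _ hmid.1 h hx.2
      · exact (hv.fluxAbsCont _ _ hx.1 h hmid.2).symm
    have h1 := hac.integral_deriv_eq_sub
    have h2 : ∫ s in (1 / 2)..x, deriv (flux α v) s = ∫ s in (1 / 2)..x, -φ s := by
      refine intervalIntegral.integral_congr_ae ?_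
      rw [Filter.EventuallyEq, ae_restrict_iff' measurableSet_Ioo] at hφ
      filter_upwards [hφ] with s hs hsx
      exact hs (hsubI hmid hx (uIoc_subset_uIcc hsx))
    have hsub' : ∀ {z : ℝ}, z ∈ Ioo (0 : ℝ) 1 → IntervalIntegrable φ volume 0 z := fun hz =>
      hφi.mono_set (by
        rw [uIcc_of_le zero_le_one, uIcc_of_le hz.1.le]; exact Icc_subset_Icc_right hz.2.le)
    have h3 := intervalIntegral.integral_interval_sub_left (hsub' hx) (hsub' hmid)
    rw [h2, intervalIntegral.integral_neg, ← h3] at h1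
    simp only [d₂, headInt]
    linarith
  have hderiv : ∀ x ∈ Ioo (0 : ℝ) 1, deriv v x = weight α x * (weight α x * (d₂ - headInt φ x)) := by
    intro x hx
    rw [← hfluxv x hx, ← mul_assoc, weight_mul_self hx.1, flux, ← mul_assoc,
      ← Real.rpow_add hx.1, neg_add_cancel, Real.rpow_zero, one_mul]
  have hcw : ∀ {x : ℝ}, x ∈ Ioo (0 : ℝ) 1 → uIcc x 1 ⊆ Ioc 0 1 := fun hx => by
    rw [uIcc_of_le hx.2.le]; exact fun s hs => ⟨hx.1.trans_le hs.1, hs.2⟩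
  have hw : ContinuousOn (weight α) (Ioc 0 1) := continuousOn_weight.mono fun _ hs => hs.1
  have hh : ContinuousOn (headInt φ) (Ioc 0 1) :=
    (continuousOn_headInt (Lp.memLp φ)).mono Ioc_subset_Icc_self
  -- Both functions vanish at `1` and their fluxes differ by a constant, so they differ by a
  -- multiple of `∫ₓ¹ s^{-α} ds`.
  have hdiff : ∀ x ∈ Ioo (0 : ℝ) 1, v x - tailInt α (fun s => weight α s * (headInt φ s - d)) x =
      (d - d₂) * ∫ s in x..1, weight α s * weight α s := by
    intro x hx
    have h1 := (hv.memH1.absCont x hx).integral_deriv_eq_sub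
    rw [hv.memH1.right_zero, zero_sub] at h1
    have h2 : ∫ s in x..1, deriv v s =
        ∫ s in x..1, weight α s * (weight α s * (d₂ - headInt φ s)) := by
      rw [intervalIntegral.integral_of_le hx.2.le, intervalIntegral.integral_of_le hx.2.le,
        integral_Ioc_eq_integral_Ioo, integral_Ioc_eq_integral_Ioo]
      exact setIntegral_congr_fun measurableSet_Ioo fun s hs =>
        hderiv s ⟨hx.1.trans hs.1, hs.2⟩
    have hint : ∀ {F : ℝ → ℝ}, ContinuousOn F (Ioc 0 1) → IntervalIntegrable F volume x 1 :=
      fun hF => (hF.mono (hcw hx)).intervalIntegrable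
    rw [tailInt, ← neg_eq_iff_eq_neg.2 h1.symm.symm, h2, ← intervalIntegral.integral_const_mul,
      ← intervalIntegral.integral_neg, ← intervalIntegral.integral_sub]
    · refine intervalIntegral.integral_congr fun s _ => ?_
      ring
    · exact hint (hw.mul (hw.mul (continuousOn_const.sub hh))).neg
    · exact hint (hw.mul (hw.mul (hh.sub continuousOn_const)))
  -- The boundary condition at `0` removes this multiple. For `α < 1` both functions tend to `0`
  -- there while the integral stays at least `1/2`; for `1 ≤ α` both flux constants are zero.
  have hd₂ : d = d₂ := by
    rcases lt_or_ge α 1 with h1 | h1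
    · have ht : Tendsto (tailInt α fun s => weight α s * (headInt φ s - d)) (𝓝[>] 0) (𝓝 0) := by
        have h := tendsto_tailInt_zero h1 (q := ContinuousLinearMap.adjoint (factorOp hα) φ)
          (by rw [adjoint_factorOp]; exact inner_traceVec_traceProj _)
        refine h.congr' ?_
        filter_upwards [Ioo_mem_nhdsGT zero_lt_one] with x hx
        exact tailInt_congr hd hx
      have h2 := (((hv.bc.1 h1).sub ht).abs)
      rw [sub_zero, abs_zero] at h2
      have h3 : |d - d₂| * (1 / 2) ≤ 0 := by
        refine ge_of_tendsto h2 ?_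
        filter_upwards [Ioo_mem_nhdsGT (show (0 : ℝ) < 1 / 2 by norm_num)] with x hx
        have hx1 : x ∈ Ioo (0 : ℝ) 1 := ⟨hx.1, hx.2.trans (by norm_num)⟩
        rw [hdiff x hx1, abs_mul]
        refine mul_le_mul_of_nonneg_left (le_trans ?_ (le_abs_self _)) (abs_nonneg _)
        have h4 : ∫ s in x..1, (1 : ℝ) ≤ ∫ s in x..1, weight α s * weight α s := by
          refine intervalIntegral.integral_mono_on_of_le_Ioo hx1.2.le (by simp)
            ((hw.mul hw).mono (hcw hx1)).intervalIntegrable fun s hs => ?_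
          have := one_le_weight hα.1 (s := s) ⟨hx1.1.trans hs.1, hs.2⟩
          nlinarith
        rw [intervalIntegral.integral_const, smul_eq_mul, mul_one] at h4
        linarith [hx.2]
      have h5 : |d - d₂| = 0 := le_antisymm (by linarith) (abs_nonneg _)
      exact sub_eq_zero.1 (abs_eq_zero.1 h5)
    · rw [hd0 h1]
      have h2 : Tendsto (fun x => d₂ - headInt φ x) (𝓝[>] 0) (𝓝 (d₂ - 0)) :=
        tendsto_const_nhds.sub (tendsto_headInt_zero (Lp.memLp φ))
      rw [sub_zero] at h2
      refine tendsto_nhds_unique (hv.bc.2 h1) (h2.congr' ?_)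
      filter_upwards [Ioo_mem_nhdsGT zero_lt_one] with x hx
      exact (hfluxv x hx).symm
  filter_upwards [factorOp_adjoint_ae hα hd, ae_restrict_mem measurableSet_Ioo] with x hx hx0
  have := hdiff x hx0
  rw [hd₂, sub_self, zero_mul, sub_eq_zero] at this
  rw [hx, this, hd₂]

/-- The representative of `C C†φ` in the domain of `A` is continuous, so if it is null it vanishes
identically, and `A` sends it to both `0` and `-φ`. This makes the eigenvalues nonzero. -/
theorem eq_zero_of_factorOp_adjoint_eq_zero (hα : α ∈ Ioo (0 : ℝ) 2) {φ : L2I}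
    (h : factorOp hα (ContinuousLinearMap.adjoint (factorOp hα) φ) = 0) : φ = 0 := by
  obtain ⟨v, hv, hvae, hA⟩ := exists_memDomA_of_factorOp hα φ
  rw [h] at hvae
  have hcont : ContinuousOn v (Ioo 0 1) := by
    intro x hx
    have hx2 : x / 2 ∈ Ioo (0 : ℝ) 1 := ⟨by linarith [hx.1], by linarith [hx.1, hx.2]⟩
    have h := (hv.memH1.absCont _ hx2).continuousOn
    rw [uIcc_of_le hx2.2.le] at h
    exact (h.continuousAt (Icc_mem_nhds (by linarith [hx.1]) hx.2)).continuousWithinAt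
  have h0 : v =ᵐ[muI] fun _ => 0 := hvae.symm.trans (Lp.coeFn_zero ℝ 2 muI)
  have hv0 : EqOn v (fun _ => 0) (Ioo 0 1) :=
    Measure.eqOn_open_of_ae_eq h0 isOpen_Ioo hcont continuousOn_const
  have hflux : EqOn (flux α v) (fun _ => 0) (Ioo 0 1) := by
    intro x hx
    rw [flux, (hv0.eventuallyEq_of_mem (Ioo_mem_nhds hx.1 hx.2)).deriv_eq]
    simp
  rw [Lp.eq_zero_iff_ae_eq_zero]
  filter_upwards [hA, ae_restrict_mem measurableSet_Ioo] with x hx hx0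
  rw [opA_congr hflux hx0] at hx
  simpa using hx.symm

end Domain
-- Hilbert bases of eigenvectors.
section Eigenbasis

variable {H : Type u} [NormedAddCommGroup H] [InnerProductSpace ℝ H]

/-- Distinct vectors are at distance `√2`, so the balls of radius `1/2` are disjoint. Countability
allows series over the basis to be integrated term by term. -/
theorem _root_.Orthonormal.countable [TopologicalSpace.SeparableSpace H] {ι : Type*} {v : ι → H}
    (hv : Orthonormal ℝ v) : Countable ι := by
  rw [← Set.countable_univ_iff]
  refine Set.PairwiseDisjoint.countable_of_isOpen (s := fun i => Metric.ball (v i) (1 / 2)) ?_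
    (fun i _ => Metric.isOpen_ball) fun i _ => ⟨v i, by simp⟩
  intro i _ j _ hij
  refine Metric.ball_disjoint_ball ?_
  have h1 : dist (v i) (v j) ^ 2 = 2 := by
    rw [dist_eq_norm, norm_sub_sq_real, hv.1, hv.1, hv.2 hij]; norm_num
  have h2 : 0 ≤ dist (v i) (v j) := dist_nonneg
  nlinarith

/-- The spectral theorem: a compact symmetric operator has a Hilbert basis of eigenvectors. -/
theorem exists_hilbertBasis_eigenvectors [CompleteSpace H] (A : H →L[ℝ] H)
    (hc : IsCompactOperator A) (hs : (A : H →ₗ[ℝ] H).IsSymmetric) :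
    ∃ (ι : Type u) (b : HilbertBasis ι ℝ H) (κ : ι → ℝ), ∀ i, A (b i) = κ i • b i := by
  have hclosed : ∀ μ : ℝ, IsClosed (Module.End.eigenspace (A : H →ₗ[ℝ] H) μ : Set H) := by
    intro μ
    have : (Module.End.eigenspace (A : H →ₗ[ℝ] H) μ : Set H) = {x | A x = μ • x} := by
      ext x; exact Module.End.mem_eigenspace_iff
    rw [this]
    exact isClosed_eq A.continuous (continuous_const_smul μ)
  have hcomplete : ∀ μ : ℝ, CompleteSpace (Module.End.eigenspace (A : H →ₗ[ℝ] H) μ) := fun μ =>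
    (hclosed μ).completeSpace_coe
  -- Bases of all eigenspaces, the kernel included, are put together; for most `μ` the eigenspace is
  -- trivial and contributes nothing.
  choose w e he using fun μ : ℝ => exists_hilbertBasis ℝ (Module.End.eigenspace (A : H →ₗ[ℝ] H) μ)
  have horth := hs.orthogonalFamily_eigenspaces.orthonormal_sigma_orthonormal
    (v_family := fun μ => e μ) (fun μ => (e μ).orthonormal)
  refine ⟨(μ : ℝ) × w μ, HilbertBasis.mkOfOrthogonalEqBot horth ?_, fun i => i.1, fun i => ?_⟩
  · rw [Submodule.eq_bot_iff]
    intro x hx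
    have h1 : x ∈ (⨆ μ, Module.End.eigenspace (A : H →ₗ[ℝ] H) μ)ᗮ := by
      rw [← Submodule.iInf_orthogonal, Submodule.mem_iInf]
      intro μ
      rw [Submodule.mem_orthogonal]
      intro u hu
      have h2 := (e μ).hasSum_repr ⟨u, hu⟩
      have h3 : HasSum (fun i => inner ℝ ((((e μ).repr ⟨u, hu⟩ i) • e μ i :
          Module.End.eigenspace (A : H →ₗ[ℝ] H) μ) : H) x) (inner ℝ u x) :=
        ((h2.mapL (Submodule.subtypeL _)).mapL ((innerSL ℝ).flip x))
      refine h3.unique ?_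
      have h4 : ∀ i, inner ℝ ((e μ i : Module.End.eigenspace (A : H →ₗ[ℝ] H) μ) : H) x = 0 :=
        fun i => Submodule.mem_orthogonal _ _ |>.1 hx _ (Submodule.subset_span ⟨⟨μ, i⟩, rfl⟩)
      simp only [Submodule.coe_smul, inner_smul_left, h4, mul_zero]
      exact hasSum_zero
    rw [ContinuousLinearMap.orthogonalComplement_iSup_eigenspaces_eq_bot hc hs] at h1
    exact h1
  · rw [HilbertBasis.coe_mkOfOrthogonalEqBot]
    exact Module.End.mem_eigenspace_iff.1 (e i.1 i.2).2

end Eigenbasis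

/-! ### From coordinates to the weak equation. -/

section WeakForm

variable {H : Type*} [NormedAddCommGroup H] [InnerProductSpace ℝ H]
  {ι : Type*} {b : HilbertBasis ι ℝ H} {κ : ι → ℝ} {T : ℝ} {y₀ : H} {f y : ℝ → H}

theorem IsCoordSolution.initial (hT : 0 ≤ T) (hy : IsCoordSolution b κ T y₀ f y) : y 0 = y₀ :=
  ext_inner_basis (b := b) fun i => by
    rw [hy.equation i 0 (left_mem_Icc.2 hT)]; simp

theorem IsCoordSolution.congr_eqOn {z : ℝ → H} (hy : IsCoordSolution b κ T y₀ f y)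
    (h : EqOn z y (Icc 0 T)) : IsCoordSolution b κ T y₀ f z := by
  refine ⟨hy.continuousOn.congr h, fun i t ht => ?_⟩
  rw [h ht, hy.equation i t ht]
  congr 1
  refine intervalIntegral.integral_congr fun s hs => ?_
  rw [uIcc_of_le ht.1] at hs
  simp only [h ⟨hs.1, hs.2.trans ht.2⟩]

/-- The equation tested against `K φ`, for `K` symmetric and diagonal in the basis. -/
theorem IsCoordSolution.inner_eq [CompleteSpace H] (hy : IsCoordSolution b κ T y₀ f y)
    (hf : MemLp f 2 (volume.restrict (Ioo 0 T))) (hκ : ∀ i, 0 < κ i) {K : H →L[ℝ] H}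
    (hKs : ∀ x z, inner ℝ (K x) z = inner ℝ x (K z)) (hK : ∀ i, K (b i) = κ i • b i) (φ : H)
    {t : ℝ} (ht : t ∈ Icc 0 T) :
    inner ℝ (K φ) (y t) = inner ℝ (K φ) y₀ +
      ∫ s in Ioo 0 t, (-inner ℝ φ (y s) + inner ℝ (K φ) (f s)) := by
  have hsub : Ioo 0 t ⊆ Ioo 0 T := Ioo_subset_Ioo_right ht.2
  have hfi : IntegrableOn f (Ioo 0 t) :=
    IntegrableOn.mono_set (hf.integrable one_le_two) hsub
  have hyi : IntegrableOn y (Ioo 0 t) :=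
    (hy.continuousOn.integrableOn_compact isCompact_Icc).mono_set
      (hsub.trans Ioo_subset_Icc_self)
  have hint : IntegrableOn (fun s => K (f s) - y s) (Ioo 0 t) := (K.integrable_comp hfi).sub hyi
  -- Applying `K` cancels the unbounded factors `κᵢ⁻¹`, so the coordinate equations combine into one
  -- Bochner identity in `H`.
  have hV : K (y t) = K y₀ + ∫ s in Ioo 0 t, (K (f s) - y s) := by
    refine ext_inner_basis (b := b) fun i => ?_
    have h1 : inner ℝ (b i) (∫ s in Ioo 0 t, (K (f s) - y s)) =
        ∫ s in Ioo 0 t, inner ℝ (b i) (K (f s) - y s) := (integral_inner hint (b i)).symm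
    have h2 : ∀ z, inner ℝ (b i) (K z) = κ i * inner ℝ (b i) z := fun z => by
      rw [← hKs, hK, inner_smul_left]; rfl
    rw [inner_add_right, h1, h2, h2, hy.equation i t ht, mul_add,
      intervalIntegral.integral_of_le ht.1, integral_Ioc_eq_integral_Ioo, ← integral_const_mul]
    congr 1
    refine integral_congr_ae (Eventually.of_forall fun s => ?_)
    have := (hκ i).ne'
    simp only [inner_sub_right, h2]
    field_simp
    ring
  rw [hKs, hV, inner_add_right, hKs, ← integral_inner hint]
  congr 1
  refine integral_congr_ae (Eventually.of_forall fun s => ?_)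
  simp only [inner_sub_right, hKs]
  ring

end WeakForm

/-! ### Restriction to subsets and the cost functionals. -/

section Indicator

variable {s : Set ℝ}

theorem memLp_indicator (hs : NullMeasurableSet s) {f : ℝ → ℝ} (hf : MemLp f 2 muI) :
    MemLp (s.indicator f) 2 muI := by
  have hs' : NullMeasurableSet s muI := hs.mono_ac Measure.absolutelyContinuous_restrict
  obtain ⟨t, -, ht, hts⟩ := hs'.exists_measurable_superset_ae_eq
  exact (memLp_congr_ae (indicator_ae_eq_of_ae_eq_set hts)).1 (hf.indicator ht)

/-- Multiplication by the indicator function of `s` on `L²(0,1)`. -/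
noncomputable def indicatorOp (hs : NullMeasurableSet s) : L2I →L[ℝ] L2I :=
  LinearMap.mkContinuous
    { toFun := fun f => (memLp_indicator hs (Lp.memLp f)).toLp _
      map_add' := fun f g => by
        rw [← MemLp.toLp_add, MemLp.toLp_eq_toLp_iff]
        filter_upwards [Lp.coeFn_add f g] with x hx
        by_cases h : x ∈ s
        · simpa only [Pi.add_apply, indicator_of_mem h] using hx
        · simp [h]
      map_smul' := fun c f => by
        rw [← MemLp.toLp_const_smul, MemLp.toLp_eq_toLp_iff]
        filter_upwards [Lp.coeFn_smul c f] with x hx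
        by_cases h : x ∈ s
        · simpa only [RingHom.id_apply, Pi.smul_apply, indicator_of_mem h] using hx
        · simp [h] }
    1 fun f => by
      rw [one_mul]
      refine Lp.norm_le_norm_of_ae_le ?_
      filter_upwards [(memLp_indicator hs (Lp.memLp f)).coeFn_toLp] with x hx
      change ‖(memLp_indicator hs (Lp.memLp f)).toLp _ x‖ ≤ _
      rw [hx]
      exact norm_indicator_le_norm_self _ _

theorem indicatorOp_coeFn (hs : NullMeasurableSet s) (f : L2I) :
    indicatorOp hs f =ᵐ[muI] s.indicator f :=
  (memLp_indicator hs (Lp.memLp f)).coeFn_toLp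

/-- Written as a distance after a continuous linear map, the cost is visibly continuous and convex.
-/
theorem cost_eq_norm (hs : NullMeasurableSet s) (hsub : s ⊆ Ioo 0 1) (yT z : L2I) :
    cost s yT z = dist (indicatorOp hs z) (indicatorOp hs yT) := by
  have hs' : NullMeasurableSet s muI := hs.mono_ac Measure.absolutelyContinuous_restrict
  obtain ⟨t, -, ht, hts⟩ := hs'.exists_measurable_superset_ae_eq
  rw [dist_eq_norm, ← map_sub, Lp.norm_def, cost, eLpNorm_congr_ae (indicatorOp_coeFn hs (z - yT)),
    ← eLpNorm_congr_ae (indicator_ae_eq_of_ae_eq_set hts), eLpNorm_indicator_eq_eLpNorm_restrict ht,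
    Measure.restrict_congr_set hts, Measure.restrict_restrict₀ hs', inter_eq_left.2 hsub]
  congr 1
  refine eLpNorm_congr_ae ?_
  filter_upwards [ae_restrict_of_ae_restrict_of_subset hsub (Lp.coeFn_sub z yT)] with x hx
  rw [hx, Pi.sub_apply]

theorem continuous_cost (hs : NullMeasurableSet s) (hsub : s ⊆ Ioo 0 1) (yT : L2I) :
    Continuous (cost s yT) := by
  simp_rw [funext (cost_eq_norm hs hsub yT)]
  fun_prop

theorem convexOn_cost (hs : NullMeasurableSet s) (hsub : s ⊆ Ioo 0 1) (yT : L2I) :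
    ConvexOn ℝ univ (cost s yT) := by
  simp_rw [funext (cost_eq_norm hs hsub yT)]
  exact (convexOn_univ_dist (indicatorOp hs yT)).comp_linearMap (indicatorOp hs).toLinearMap

end Indicator

/-! ### Weak solutions are exactly the coordinate solutions. -/

section Solution

variable {α T : ℝ} {ω ω₁ ω₂ : Set ℝ} {y₀ : L2I} {g u₁ u₂ : Control T}
  {ι : Type*} {b : HilbertBasis ι ℝ L2I} {κ : ι → ℝ} {z : ℝ → L2I}

/-- The right-hand side as a function of time with values in `L²(0,1)`. -/
noncomputable def sourceLp (hω : NullMeasurableSet ω) (hω₁ : NullMeasurableSet ω₁)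
    (hω₂ : NullMeasurableSet ω₂) (g u₁ u₂ : Control T) (t : ℝ) : L2I :=
  indicatorOp hω (g t) + indicatorOp hω₁ (u₁ t) + indicatorOp hω₂ (u₂ t)

variable (hω : NullMeasurableSet ω) (hω₁ : NullMeasurableSet ω₁) (hω₂ : NullMeasurableSet ω₂)

theorem sourceLp_coeFn (t : ℝ) :
    sourceLp hω hω₁ hω₂ g u₁ u₂ t =ᵐ[muI] source ω ω₁ ω₂ g u₁ u₂ t := by
  filter_upwards [Lp.coeFn_add (indicatorOp hω (g t) + indicatorOp hω₁ (u₁ t))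
      (indicatorOp hω₂ (u₂ t)), Lp.coeFn_add (indicatorOp hω (g t)) (indicatorOp hω₁ (u₁ t)),
    indicatorOp_coeFn hω (g t), indicatorOp_coeFn hω₁ (u₁ t), indicatorOp_coeFn hω₂ (u₂ t)]
    with x h1 h2 h3 h4 h5
  rw [sourceLp, h1, Pi.add_apply, h2, Pi.add_apply, h3, h4, h5, source]

theorem memLp_sourceLp :
    MemLp (sourceLp hω hω₁ hω₂ g u₁ u₂) 2 (volume.restrict (Ioo 0 T)) :=
  ((memLp_comp_clm _ g).add (memLp_comp_clm _ u₁)).add (memLp_comp_clm _ u₂)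

theorem setIntegral_mul_eq_inner {h v : ℝ → ℝ} {p q : L2I} (hp : p =ᵐ[muI] h) (hq : q =ᵐ[muI] v) :
    ∫ x in Ioo (0 : ℝ) 1, h x * v x = inner ℝ q p := by
  rw [L2.inner_def]
  refine integral_congr_ae ?_
  filter_upwards [hp, hq] with x h1 h2
  rw [← h1, ← h2]; simp

theorem inner_factorOp_adjoint (hα : α ∈ Ioo (0 : ℝ) 2) (x z : L2I) :
    inner ℝ ((factorOp hα ∘L ContinuousLinearMap.adjoint (factorOp hα)) x) z =
      inner ℝ x ((factorOp hα ∘L ContinuousLinearMap.adjoint (factorOp hα)) z) := by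
  rw [ContinuousLinearMap.comp_apply, ContinuousLinearMap.comp_apply,
    ← ContinuousLinearMap.adjoint_inner_right, ContinuousLinearMap.adjoint_inner_left]

/-- Test with the representative of `C C† bᵢ = κᵢ bᵢ` in the domain of `A`, which `A` sends to
`-bᵢ`, and divide by `κᵢ`. -/
theorem IsSolution.isCoordSolution (hα : α ∈ Ioo (0 : ℝ) 2) (hκ : ∀ i, 0 < κ i)
    (hK : ∀ i, factorOp hα (ContinuousLinearMap.adjoint (factorOp hα) (b i)) = κ i • b i)
    (hz : IsSolution α T ω ω₁ ω₂ y₀ g u₁ u₂ z) :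
    IsCoordSolution b κ T y₀ (sourceLp hω hω₁ hω₂ g u₁ u₂) z := by
  refine ⟨hz.continuousOn, fun i t ht => ?_⟩
  obtain ⟨v, hv, hvK, hvA⟩ := exists_memDomA_of_factorOp hα (b i)
  rw [hK] at hvK
  have hA : (-b i : L2I) =ᵐ[muI] opA α v := by
    filter_upwards [hvA, Lp.coeFn_neg (b i)] with x h1 h2
    rw [h1, h2]; rfl
  have h := hz.equation v hv t ht
  have hinner : ∀ p : L2I, ∫ x in Ioo (0 : ℝ) 1, p x * v x = κ i * inner ℝ (b i) p := fun p => by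
    rw [setIntegral_mul_eq_inner (ae_eq_refl _) hvK, inner_smul_left]; rfl
  have hinner' : ∀ p : L2I, ∫ x in Ioo (0 : ℝ) 1, p x * opA α v x = -inner ℝ (b i) p := fun p => by
    rw [setIntegral_mul_eq_inner (ae_eq_refl _) hA, inner_neg_left]
  have hsource : ∀ s, ∫ x in Ioo (0 : ℝ) 1, source ω ω₁ ω₂ g u₁ u₂ s x * v x =
      κ i * inner ℝ (b i) (sourceLp hω hω₁ hω₂ g u₁ u₂ s) := fun s => by
    rw [setIntegral_mul_eq_inner (sourceLp_coeFn hω hω₁ hω₂ s) hvK, inner_smul_left]; rfl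
  simp only [hinner, hinner', hsource] at h
  have hi := (hκ i).ne'
  rw [intervalIntegral.integral_of_le ht.1, integral_Ioc_eq_integral_Ioo]
  refine mul_left_cancel₀ hi ?_
  rw [h, mul_add, ← integral_const_mul]
  congr 1
  refine integral_congr_ae (Eventually.of_forall fun s => ?_)
  simp only
  field_simp

/-- Every test function is `C C†φ` with `φ = -A v`, so the equation is `inner_eq`. The energy clause
holds because `z t` is in the range of `C` for almost every `t`. -/
theorem IsCoordSolution.isSolution [Countable ι] (hα : α ∈ Ioo (0 : ℝ) 2) (hT : 0 ≤ T) {κm : ℝ}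
    (hκ : ∀ i, 0 < κ i) (hκm : ∀ i, κ i ≤ κm)
    (hK : ∀ i, factorOp hα (ContinuousLinearMap.adjoint (factorOp hα) (b i)) = κ i • b i)
    (hz : IsCoordSolution b κ T y₀ (sourceLp hω hω₁ hω₂ g u₁ u₂) z) :
    IsSolution α T ω ω₁ ω₂ y₀ g u₁ u₂ z := by
  have hf := memLp_sourceLp (g := g) (u₁ := u₁) (u₂ := u₂) hω hω₁ hω₂
  refine ⟨hz.continuousOn, hz.initial hT, ?_, fun v hv t ht => ?_⟩
  · have hlt := hz.lintegral_tsum_lt_top hκ hκm hT hf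
    have hpos : ∀ t i, 0 ≤ (κ i)⁻¹ * inner ℝ (b i) (z t) ^ 2 := fun t i =>
      mul_nonneg (inv_pos.2 (hκ i)).le (sq_nonneg _)
    -- The representative is meaningful only where the series converges; at the remaining times, a
    -- null set, it is `0`.
    have hex : ∀ t, ∃ Y : ℝ → ℝ,
        ∑' i, ENNReal.ofReal ((κ i)⁻¹ * inner ℝ (b i) (z t) ^ 2) < ⊤ →
        (z t : ℝ → ℝ) =ᵐ[muI] Y ∧ MemH1 α Y ∧ (α < 1 → Tendsto Y (𝓝[>] 0) (𝓝 0)) ∧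
        ∫⁻ x in Ioo (0 : ℝ) 1, ENNReal.ofReal ((x ^ (α / 2) * deriv Y x) ^ 2) ≤
          ∑' i, ENNReal.ofReal ((κ i)⁻¹ * inner ℝ (b i) (z t) ^ 2) := by
      intro t
      by_cases ht : ∑' i, ENNReal.ofReal ((κ i)⁻¹ * inner ℝ (b i) (z t) ^ 2) < ⊤
      · have hsum : Summable fun i => (κ i)⁻¹ * inner ℝ (b i) (z t) ^ 2 := by
          have := ENNReal.summable_toReal ht.ne
          simpa only [ENNReal.toReal_ofReal (hpos t _)] using this
        obtain ⟨q, hq, hqn⟩ := exists_eq_of_summable_inv_mul_sq hκ hK hsum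
        obtain ⟨Y, h1, h2, h3, h4⟩ := exists_memH1_of_factorOp hα q
        rw [hq] at h1
        rw [hqn, ENNReal.ofReal_tsum_of_nonneg (hpos t) hsum] at h4
        exact ⟨Y, fun _ => ⟨h1, h2, h3, h4⟩⟩
      · exact ⟨0, fun h => absurd h ht⟩
    choose Y hY using hex
    have hm : AEMeasurable (fun t => ∑' i, ENNReal.ofReal ((κ i)⁻¹ * inner ℝ (b i) (z t) ^ 2))
        (volume.restrict (Ioo 0 T)) := by
      refine AEMeasurable.tsum fun i => AEMeasurable.ennreal_ofReal ?_
      have hc : ContinuousOn (fun s => (κ i)⁻¹ * inner ℝ (b i) (z s) ^ 2) (Icc 0 T) :=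
        continuousOn_const.mul ((continuousOn_const.inner hz.continuousOn).pow 2)
      exact (hc.mono Ioo_subset_Icc_self).aemeasurable measurableSet_Ioo
    have hae := ae_lt_top' hm hlt.ne
    refine ⟨Y, ?_, lt_of_le_of_lt (lintegral_mono_ae ?_) hlt⟩
    · filter_upwards [hae] with t ht
      exact ⟨(hY t ht).1, (hY t ht).2.1, (hY t ht).2.2.1⟩
    · filter_upwards [hae] with t ht
      exact (hY t ht).2.2.2
  · set φ : L2I := hv.memL2.neg.toLp (-opA α v)
    have hφ : φ =ᵐ[muI] -opA α v := hv.memL2.neg.coeFn_toLp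
    have hvφ : opA α v =ᵐ[muI] fun x => -φ x := by
      filter_upwards [hφ] with x hx
      rw [hx]; simp
    have hvK := factorOp_adjoint_eq_of_memDomA hα hv hvφ
    have hA : (-φ : L2I) =ᵐ[muI] opA α v := by
      filter_upwards [hvφ, Lp.coeFn_neg φ] with x h1 h2
      rw [h1, h2]; rfl
    have h := hz.inner_eq hf hκ (inner_factorOp_adjoint hα) hK φ ht
    have hinner : ∀ p : L2I, ∫ x in Ioo (0 : ℝ) 1, p x * v x =
        inner ℝ ((factorOp hα ∘L ContinuousLinearMap.adjoint (factorOp hα)) φ) p := fun p =>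
      setIntegral_mul_eq_inner (ae_eq_refl _) hvK
    have hinner' : ∀ p : L2I, ∫ x in Ioo (0 : ℝ) 1, p x * opA α v x = -inner ℝ φ p := fun p => by
      rw [setIntegral_mul_eq_inner (ae_eq_refl _) hA, inner_neg_left]
    have hsource : ∀ s, ∫ x in Ioo (0 : ℝ) 1, source ω ω₁ ω₂ g u₁ u₂ s x * v x =
        inner ℝ ((factorOp hα ∘L ContinuousLinearMap.adjoint (factorOp hα)) φ)
          (sourceLp hω hω₁ hω₂ g u₁ u₂ s) := fun s =>
      setIntegral_mul_eq_inner (sourceLp_coeFn hω hω₁ hω₂ s) hvK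
    simp only [hinner, hinner', hsource]
    exact h

/-- An eigenbasis of `C C†`, the inverse of `-A`. -/
theorem exists_eigenbasis_factorOp (hα : α ∈ Ioo (0 : ℝ) 2) :
    ∃ (ι : Type) (b : HilbertBasis ι ℝ L2I) (κ : ι → ℝ) (κm : ℝ), Countable ι ∧ (∀ i, 0 < κ i) ∧
      (∀ i, κ i ≤ κm) ∧
      ∀ i, factorOp hα (ContinuousLinearMap.adjoint (factorOp hα) (b i)) = κ i • b i := by
  have : Fact ((2 : ENNReal) ≠ ⊤) := ⟨ENNReal.ofNat_ne_top⟩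
  have : SecondCountableTopology L2I := Lp.SecondCountableTopology
  set C := factorOp hα
  obtain ⟨ι, b, κ, hb⟩ := exists_hilbertBasis_eigenvectors (C ∘L ContinuousLinearMap.adjoint C)
    ((isCompactOperator_factorOp hα).comp_clm _) (inner_factorOp_adjoint hα)
  -- This gives both the upper bound `‖C†‖²` and, with injectivity of `C C†`, the strict positivity
  -- of the eigenvalues.
  have hκ : ∀ i, κ i = ‖ContinuousLinearMap.adjoint C (b i)‖ ^ 2 := by
    intro i
    have h1 : inner ℝ (b i) (C (ContinuousLinearMap.adjoint C (b i))) = κ i := by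
      have := hb i
      rw [ContinuousLinearMap.comp_apply] at this
      rw [this, inner_smul_right, real_inner_self_eq_norm_sq, b.orthonormal.1]
      ring
    rw [← h1, ← ContinuousLinearMap.adjoint_inner_left, real_inner_self_eq_norm_sq]
  refine ⟨ι, b, κ, ‖ContinuousLinearMap.adjoint C‖ ^ 2, b.orthonormal.countable, fun i => ?_,
    fun i => ?_, hb⟩
  · rw [hκ i]
    refine pow_pos (norm_pos_iff.2 fun h0 => ?_) 2
    have h1 : b i = 0 := eq_zero_of_factorOp_adjoint_eq_zero hα (by
      change C (ContinuousLinearMap.adjoint C (b i)) = 0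
      rw [h0, map_zero])
    exact b.orthonormal.ne_zero i h1
  · rw [hκ i]
    have h1 := (ContinuousLinearMap.adjoint C).le_opNorm (b i)
    rw [b.orthonormal.1, mul_one] at h1
    gcongr

end Solution

end DegenerateGame

/-! ### Well-posedness and existence of the equilibrium. -/

theorem theorem2p2 (α T M₁ M₂ : ℝ) (hα : α ∈ Set.Ioo (0 : ℝ) 2) (hT : 0 < T)
    (hM₁ : 0 < M₁) (hM₂ : 0 < M₂)
    (ω ω₁ ω₂ G₁ G₂ : Set ℝ)
    (hω : MeasureTheory.NullMeasurableSet ω) (hω_sub : ω ⊆ Set.Ioo 0 1)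
    (hω_pos : 0 < MeasureTheory.volume ω)
    (hω₁ : MeasureTheory.NullMeasurableSet ω₁) (hω₁_pos : 0 < MeasureTheory.volume ω₁)
    (hω₂ : MeasureTheory.NullMeasurableSet ω₂) (hω₂_pos : 0 < MeasureTheory.volume ω₂)
    (hG₁ : MeasureTheory.NullMeasurableSet G₁) (hG₁_sub : G₁ ⊆ Set.Ioo 0 1) (hωG₁ : ω₁ ⊆ G₁)
    (hG₂ : MeasureTheory.NullMeasurableSet G₂) (hG₂_sub : G₂ ⊆ Set.Ioo 0 1) (hωG₂ : ω₂ ⊆ G₂)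
    (y₀ yT₁ yT₂ : DegenerateGame.L2I) (hyT : yT₁ ≠ yT₂)
    (g : DegenerateGame.Control T) :
    -- the state `y(·; y₀, g, u₁, u₂)` exists and is unique on `[0,T]` for all controls
    ∃ y : DegenerateGame.Control T → DegenerateGame.Control T → ℝ → DegenerateGame.L2I,
      (∀ (u₁ u₂ : DegenerateGame.Control T) (z : ℝ → DegenerateGame.L2I),
        DegenerateGame.IsSolution α T ω ω₁ ω₂ y₀ g u₁ u₂ z ↔
          Set.EqOn z (y u₁ u₂) (Set.Icc 0 T)) ∧
      ∃ u₁ u₂ : DegenerateGame.Control T,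
        DegenerateGame.IsNashEquilibrium
          (fun v₁ v₂ => DegenerateGame.cost G₁ yT₁ (y v₁ v₂ T))
          (fun v₁ v₂ => DegenerateGame.cost G₂ yT₂ (y v₁ v₂ T))
          (DegenerateGame.admissible T M₁) (DegenerateGame.admissible T M₂) u₁ u₂ := by
  obtain ⟨ι, b, κ, κm, hι, hκ, hκm, hK⟩ := DegenerateGame.exists_eigenbasis_factorOp hα
  choose y hy using fun u₁ u₂ : DegenerateGame.Control T =>
    DegenerateGame.exists_isCoordSolution (b := b) (y₀ := y₀) hκ hκm hT.le
      (DegenerateGame.memLp_sourceLp (g := g) (u₁ := u₁) (u₂ := u₂) hω hω₁ hω₂)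
  refine ⟨y, fun u₁ u₂ z => ⟨fun hz => ?_, fun hz => ?_⟩, ?_⟩
  · exact (hy u₁ u₂).eqOn (hz.isCoordSolution hω hω₁ hω₂ hα hκ hK) hκ
      (DegenerateGame.memLp_sourceLp hω hω₁ hω₂)
  · exact ((hy u₁ u₂).congr_eqOn hz).isSolution hω hω₁ hω₂ hα hT.le hκ hκm hK
  · exact DegenerateGame.exists_isNashEquilibrium
      (DegenerateGame.isCompactOperator_factorOp hα) hK hκ hκm hT.le hM₁.le hM₂.le hy
      (DegenerateGame.continuous_cost hG₁ hG₁_sub yT₁)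
      (DegenerateGame.continuous_cost hG₂ hG₂_sub yT₂)
      (DegenerateGame.convexOn_cost hG₁ hG₁_sub yT₁)
      (DegenerateGame.convexOn_cost hG₂ hG₂_sub yT₂)
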